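/- Let $M^m$ be a connected smooth manifold and $\varphi:M^m\to\mathbb S^{m+1}$ a smooth immersion into the unit Euclidean sphere, with $M$ carrying the induced metric. Let $H=\frac1m\operatorname{trace}\nabla d\varphi$ be its mean curvature vector field. Suppose that the hypersurface is orientable, that is, it admits a globally defined smooth unit section $\eta$ of its normal bundle in $\mathbb S^{m+1}$ (as the sphere is orientable, this amounts to $M$ being orientable), and let $A=A_\eta$ be its shape operator, whose eigenvalues are the principal curvatures and whose eigenvectors are the principal directions. Suppose that $\varphi$ is proper Dupin: the number $\ell$ of distinct principal curvatures $k_1>\dots>k_\ell$ is constant on $M$, and each $k_i$ is constant along its principal directions, i.e. $v(k_i)=0$ for every $x\in M$ and every $v\in T_xM$ with $Av=k_i(x)v$. Suppose also that $\varphi$ is proper biharmonic, that is, $$\tau_2(\varphi)=-m\bigl(\Delta H+\operatorname{trace}R(d\varphi(\cdot),H)\,d\varphi(\cdot)\bigr)=0\quad\text{on }M$$ and $H$ does not vanish identically, where $\Delta=-\operatorname{trace}\nabla^2$ is the rough Laplacian on sections of $\varphi^{-1}(T\mathbb S^{m+1})$ and $R(X,Y)=[\nabla_X,\nabla_Y]-\nabla_{[X,Y]}$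 is the curvature operator of $\mathbb S^{m+1}$. Then $\varphi$ has constant mean curvature: $|H|$ is constant on $M$. -/

import Mathlib

open scoped Manifold ContDiff RealInnerProductSpace

noncomputable section

namespace SphereHypersurface

/-! ### The unit sphere of a Euclidean space: Levi-Civita connection and curvature -/

section Sphere

variable {W : Type*} [NormedAddCommGroup W] [InnerProductSpace ℝ W]

/-- The map `w ↦ w - ⟪q, w⟫ q`. For a unit vector `q` this is the orthogonal projection of the
ambient space onto the tangent space of the unit sphere at `q`. -/
def tangentProj (q w : W) : W := w - ⟪q, w⟫ • q

/-- The Levi-Civita connection of the unit sphere, on vector fields given on the ambient space and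
tangent to the sphere: the derivative in the ambient space, projected to the tangent space of the
sphere. Its values at points of the sphere depend only on the fields along the sphere. -/
def sphereConn (X Y : W → W) (q : W) : W := tangentProj q (fderiv ℝ Y q (X q))

/-- An extension of a tangent vector `x` of the unit sphere to a field tangent to the sphere. -/
def tangentExt (x : W) : W → W := fun q => tangentProj q x

/-- The curvature operator `R(X, Y) = [∇_X, ∇_Y] - ∇_{[X, Y]}` of the unit sphere at `p`, on
tangent vectors `x, y, z` at `p`, computed from extensions of these to tangent vector fields. -/
def sphereCurvature (p x y z : W) : W :=
  sphereConn (tangentExt x) (sphereConn (tangentExt y) (tangentExt z)) p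
    - sphereConn (tangentExt y) (sphereConn (tangentExt x) (tangentExt z)) p
    - sphereConn (VectorField.lieBracket ℝ (tangentExt x) (tangentExt y)) (tangentExt z) p

end Sphere

/-! ### Immersions of open subsets of `ℝ^m` into the unit sphere, in coordinates

In this section `F` is the local expression of an immersion into the unit sphere of `W` in a
coordinate chart, and `V` is the local expression of a section of the pull-back of the tangent
bundle of the sphere, i.e. `V u` is orthogonal to `F u`. -/

section Local

variable {W : Type*} [NormedAddCommGroup W] [InnerProductSpace ℝ W] {m : ℕ}

/-- The partial derivative `∂_i V`. -/
def pd {G : Type*} [NormedAddCommGroup G] [NormedSpace ℝ G]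
    (i : Fin m) (V : EuclideanSpace ℝ (Fin m) → G) (u : EuclideanSpace ℝ (Fin m)) : G :=
  fderiv ℝ V u (EuclideanSpace.single i 1)

/-- The coefficients `g_{ij} = ⟪∂_i F, ∂_j F⟫` of the induced metric. -/
def inducedMetric (F : EuclideanSpace ℝ (Fin m) → W) (u : EuclideanSpace ℝ (Fin m)) :
    Matrix (Fin m) (Fin m) ℝ :=
  Matrix.of fun i j => ⟪pd i F u, pd j F u⟫

/-- The Christoffel symbols `Γ^k_{ij}` of the Levi-Civita connection of the induced metric. -/
def christoffel (F : EuclideanSpace ℝ (Fin m) → W) (i j k : Fin m)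
    (u : EuclideanSpace ℝ (Fin m)) : ℝ :=
  (1 / 2) * ∑ l, (inducedMetric F u)⁻¹ k l *
    (pd i (fun y => inducedMetric F y j l) u + pd j (fun y => inducedMetric F y i l) u
      - pd l (fun y => inducedMetric F y i j) u)

/-- The covariant derivative `∇_i V` in the pull-back of the tangent bundle of the sphere. -/
def covDeriv (F : EuclideanSpace ℝ (Fin m) → W) (i : Fin m)
    (V : EuclideanSpace ℝ (Fin m) → W) (u : EuclideanSpace ℝ (Fin m)) : W :=
  tangentProj (F u) (pd i V u)

/-- The second fundamental form `B = ∇dF`: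
`B_{ij} = ∇_i (∂_j F) - Γ^k_{ij} ∂_k F`. -/
def secondFundForm (F : EuclideanSpace ℝ (Fin m) → W) (i j : Fin m)
    (u : EuclideanSpace ℝ (Fin m)) : W :=
  covDeriv F i (pd j F) u - ∑ k, christoffel F i j k u • pd k F u

/-- The mean curvature vector field `H = (1 / m) g^{ij} B_{ij}`. -/
def localMeanCurvature (F : EuclideanSpace ℝ (Fin m) → W) (u : EuclideanSpace ℝ (Fin m)) : W :=
  (1 / (m : ℝ)) • ∑ i, ∑ j, (inducedMetric F u)⁻¹ i j • secondFundForm F i j u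

/-- The rough Laplacian `Δ V = - trace ∇² V = - g^{ij} (∇_i ∇_j V - Γ^k_{ij} ∇_k V)` on sections of
the pull-back of the tangent bundle of the sphere. -/
def roughLaplacian (F V : EuclideanSpace ℝ (Fin m) → W) (u : EuclideanSpace ℝ (Fin m)) : W :=
  -∑ i, ∑ j, (inducedMetric F u)⁻¹ i j •
    (covDeriv F i (covDeriv F j V) u - ∑ k, christoffel F i j k u • covDeriv F k V u)

/-- The bitension field `τ₂ = - m (Δ H + trace R(dF ·, H) dF ·)`. -/
def localBitension (F : EuclideanSpace ℝ (Fin m) → W) (u : EuclideanSpace ℝ (Fin m)) : W :=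
  -((m : ℝ) • (roughLaplacian F (localMeanCurvature F) u
    + ∑ i, ∑ j, (inducedMetric F u)⁻¹ i j •
        sphereCurvature (F u) (pd i F u) (localMeanCurvature F u) (pd j F u)))

end Local

/-! ### Hypersurfaces `φ : M → 𝕊^{m+1}` -/

section Global

variable {m : ℕ} {M : Type*} [TopologicalSpace M] [ChartedSpace (EuclideanSpace ℝ (Fin m)) M]

/-- The Euclidean space containing the sphere `𝕊^{m+1}`. -/
abbrev Ambient (m : ℕ) : Type := EuclideanSpace ℝ (Fin (m + 1 + 1))

/-- The unit Euclidean sphere `𝕊^{m+1}`. -/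
abbrev UnitSphere (m : ℕ) : Type := Metric.sphere (0 : Ambient m) 1

/-- `φ : M → 𝕊^{m+1}` is a smooth immersion. -/
def IsSmoothImmersion (φ : M → UnitSphere m) : Prop :=
  ContMDiff (𝓡 m) (𝓡 (m + 1)) ∞ φ ∧
    ∀ x, Function.Injective (mfderiv (𝓡 m) (𝓡 (m + 1)) φ x)

/-- The expression of `φ` in a chart of `M`, as a map into the ambient Euclidean space. -/
def inChart (φ : M → UnitSphere m) (e : OpenPartialHomeomorph M (EuclideanSpace ℝ (Fin m))) :
    EuclideanSpace ℝ (Fin m) → Ambient m :=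
  fun u => (φ (e.symm u) : Ambient m)

/-- The mean curvature vector field `H` of `φ` (it does not depend on the chart). -/
def meanCurvatureVector (φ : M → UnitSphere m) (x : M) : Ambient m :=
  localMeanCurvature (inChart φ (chartAt (EuclideanSpace ℝ (Fin m)) x))
    (chartAt (EuclideanSpace ℝ (Fin m)) x x)

/-- `φ` is biharmonic: its bitension field, computed in the charts of `M`, vanishes. -/
def IsBiharmonic (φ : M → UnitSphere m) : Prop :=
  ∀ e ∈ atlas (EuclideanSpace ℝ (Fin m)) M, ∀ u ∈ e.target, localBitension (inChart φ e) u = 0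

/-- `φ` is proper biharmonic: biharmonic and not harmonic, i.e. `H` is not identically zero. -/
def IsProperBiharmonic (φ : M → UnitSphere m) : Prop :=
  IsBiharmonic φ ∧ ∃ x, meanCurvatureVector φ x ≠ 0

/-- `φ` is CMC: its mean curvature `|H|` is constant. -/
def IsCMC (φ : M → UnitSphere m) : Prop :=
  ∃ c : ℝ, ∀ x, ‖meanCurvatureVector φ x‖ = c

/-- The differential `dφ_x`, with values in the ambient Euclidean space. -/
def dmap (φ : M → UnitSphere m) (x : M) (v : TangentSpace (𝓡 m) x) : Ambient m :=
  mfderiv (𝓡 m) 𝓘(ℝ, Ambient m) (fun y => (φ y : Ambient m)) x v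

/-- The covariant derivative `∇_v V`, `v ∈ T_x M`, of a section `V` of the pull-back of the tangent
bundle of the sphere. -/
def pullbackConn (φ : M → UnitSphere m) (V : M → Ambient m) (x : M)
    (v : TangentSpace (𝓡 m) x) : Ambient m :=
  tangentProj (φ x : Ambient m) (mfderiv (𝓡 m) 𝓘(ℝ, Ambient m) V x v : Ambient m)

/-- `η` is a smooth unit section of the normal bundle of `φ` in `𝕊^{m+1}`. -/
structure IsUnitNormalField (φ : M → UnitSphere m) (η : M → Ambient m) : Prop where
  smooth : ContMDiff (𝓡 m) 𝓘(ℝ, Ambient m) ∞ η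
  norm_eq_one : ∀ x, ‖η x‖ = 1
  tangent_sphere : ∀ x, ⟪(φ x : Ambient m), η x⟫ = 0
  normal : ∀ x (v : TangentSpace (𝓡 m) x), ⟪dmap φ x v, η x⟫ = 0

/-- The hypersurface is orientable: it has a global unit normal field (the sphere being
orientable, this is the same as orientability of `M`). -/
def IsOrientableHypersurface (φ : M → UnitSphere m) : Prop :=
  ∃ η, IsUnitNormalField φ η

/-- `A v = κ v` for the shape operator `A = A_η`, given by `dφ (A v) = - ∇_v η`. -/
def ShapeEigen (φ : M → UnitSphere m) (η : M → Ambient m) (x : M) (κ : ℝ)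
    (v : TangentSpace (𝓡 m) x) : Prop :=
  -pullbackConn φ η x v = κ • dmap φ x v

/-- The principal curvatures at `x`: the eigenvalues of the shape operator. -/
def principalCurvatures (φ : M → UnitSphere m) (η : M → Ambient m) (x : M) : Set ℝ :=
  {κ | ∃ v : TangentSpace (𝓡 m) x, v ≠ 0 ∧ ShapeEigen φ η x κ v}

/-- An orientable hypersurface is proper Dupin: the number `ℓ` of distinct principal curvatures
`k_0 > ⋯ > k_{ℓ-1}` is constant on `M`, and each principal curvature function is constant along its
principal directions. (That `ℓ` is constant makes the functions `k_i` smooth.) -/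
def IsProperDupin (φ : M → UnitSphere m) : Prop :=
  ∀ η, IsUnitNormalField φ η →
    ∃ (ℓ : ℕ) (k : Fin ℓ → M → ℝ),
      (∀ x, StrictAnti fun i => k i x) ∧
      (∀ x, principalCurvatures φ η x = Set.range fun i => k i x) ∧
      ∀ i x (v : TangentSpace (𝓡 m) x), ShapeEigen φ η x (k i x) v →
        mfderiv (𝓡 m) 𝓘(ℝ, ℝ) (k i) x v = 0

end Global

end SphereHypersurface

end

/-! Write `H = f η`, so that `|H| = |f|`. Only the tangential part of the biharmonic equation is
needed. The sphere has constant curvature one (`sphereCurvature_eq`), so the curvature term is a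
multiple of `H` and has no tangential part. The tangential part of the rough Laplacian of `f η` is
`2 A(grad f)` plus `f` times the trace of `∇h`, which by Codazzi is `m grad f`. Hence `A(grad f) =
-(m/2) f grad f` (`sum_shapeForm_mul_grad`).

Suppose `grad f ≠ 0` at some point. Then near that point `-(m/2) f` is a principal curvature and
`grad f` is a principal direction for it. The Dupin condition says that this curvature is constant
along `grad f`, so `|grad f|² = df(grad f) = 0`, a contradiction
(`fderiv_scalarMeanCurvature_eq_zero`). Thus `f` is locally constant, hence constant on the
connected `M`.

The delicate point is that the ordered principal curvatures `k i` are not assumed continuous, so it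
is not immediate that one single `k i` equals `-(m/2) f` on a whole neighbourhood. Roots of `det (h
- κ g)` cannot disappear under small perturbation (`eventually_exists_det_sub_smul_eq_zero`). As
their number is constant, their order is preserved, and a continuous selection of roots keeps its
index (`eventually_eq_of_strictAnti`). -/

noncomputable section

namespace SphereHypersurface

/-! ### Calculus of coordinate partial derivatives. -/

section PartialDerivatives

variable {m : ℕ} {G : Type*} [NormedAddCommGroup G] [NormedSpace ℝ G]
  {U : Set (EuclideanSpace ℝ (Fin m))} {u : EuclideanSpace ℝ (Fin m)}

theorem differentiableAt_of_contDiffOn {f : EuclideanSpace ℝ (Fin m) → G} (hU : IsOpen U)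
    (hf : ContDiffOn ℝ ∞ f U) (hu : u ∈ U) : DifferentiableAt ℝ f u :=
  (hf.contDiffAt (hU.mem_nhds hu)).differentiableAt (by simp)

theorem contDiffOn_pd {f : EuclideanSpace ℝ (Fin m) → G} (hU : IsOpen U)
    (hf : ContDiffOn ℝ ∞ f U) (i : Fin m) : ContDiffOn ℝ ∞ (pd i f) U :=
  (hf.fderiv_of_isOpen hU (by simp)).clm_apply contDiffOn_const

theorem pd_congr {f g : EuclideanSpace ℝ (Fin m) → G} (hU : IsOpen U)
    (h : Set.EqOn f g U) (hu : u ∈ U) (i : Fin m) : pd i f u = pd i g u := by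
  have : f =ᶠ[nhds u] g := Filter.eventuallyEq_of_mem (hU.mem_nhds hu) h
  simp only [pd, this.fderiv_eq]

theorem pd_const (c : G) (i : Fin m) : pd i (fun _ => c) u = 0 := by
  simp [pd]

theorem pd_smul {f : EuclideanSpace ℝ (Fin m) → ℝ} {g : EuclideanSpace ℝ (Fin m) → G}
    (hf : DifferentiableAt ℝ f u) (hg : DifferentiableAt ℝ g u) (i : Fin m) :
    pd i (fun y => f y • g y) u = pd i f u • g u + f u • pd i g u := by
  simp only [pd]
  rw [fderiv_fun_smul hf hg]
  simp [add_comm]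

theorem pd_mul {f g : EuclideanSpace ℝ (Fin m) → ℝ}
    (hf : DifferentiableAt ℝ f u) (hg : DifferentiableAt ℝ g u) (i : Fin m) :
    pd i (fun y => f y * g y) u = pd i f u * g u + f u * pd i g u :=
  pd_smul hf hg i

theorem pd_sum {ι : Type*} (s : Finset ι) {f : ι → EuclideanSpace ℝ (Fin m) → G}
    (hf : ∀ a ∈ s, DifferentiableAt ℝ (f a) u) (i : Fin m) :
    pd i (fun y => ∑ a ∈ s, f a y) u = ∑ a ∈ s, pd i (f a) u := by
  simp only [pd]
  rw [fderiv_fun_sum hf]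
  simp

theorem pd_add {f g : EuclideanSpace ℝ (Fin m) → G}
    (hf : DifferentiableAt ℝ f u) (hg : DifferentiableAt ℝ g u) (i : Fin m) :
    pd i (fun y => f y + g y) u = pd i f u + pd i g u := by
  simp only [pd]
  rw [fderiv_fun_add hf hg]
  rfl

theorem pd_neg (f : EuclideanSpace ℝ (Fin m) → G) (i : Fin m) :
    pd i (fun y => -f y) u = -pd i f u := by
  simp [pd, fderiv_fun_neg]

theorem pd_inner {W : Type*} [NormedAddCommGroup W] [InnerProductSpace ℝ W]
    {f g : EuclideanSpace ℝ (Fin m) → W}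
    (hf : DifferentiableAt ℝ f u) (hg : DifferentiableAt ℝ g u) (i : Fin m) :
    pd i (fun y => ⟪f y, g y⟫) u = ⟪f u, pd i g u⟫ + ⟪pd i f u, g u⟫ := by
  simp only [pd]
  rw [fderiv_inner_apply ℝ hf hg]

theorem pd_pd_comm {f : EuclideanSpace ℝ (Fin m) → G} (hU : IsOpen U)
    (hf : ContDiffOn ℝ ∞ f U) (hu : u ∈ U) (i j : Fin m) :
    pd i (pd j f) u = pd j (pd i f) u := by
  have h2 : ContDiffAt ℝ ∞ f u := hf.contDiffAt (hU.mem_nhds hu)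
  have hs : IsSymmSndFDerivAt ℝ f u := h2.isSymmSndFDerivAt (by
    simpa using (WithTop.coe_le_coe.2 le_top : ((2 : ℕ∞) : WithTop ℕ∞) ≤ ∞))
  have hd : DifferentiableAt ℝ (fderiv ℝ f) u :=
    differentiableAt_of_contDiffOn hU (hf.fderiv_of_isOpen hU (by simp)) hu
  have key : ∀ a b : Fin m, pd a (pd b f) u =
      fderiv ℝ (fderiv ℝ f) u (EuclideanSpace.single a 1) (EuclideanSpace.single b 1) := by
    intro a b
    change fderiv ℝ (fun y => fderiv ℝ f y (EuclideanSpace.single b 1)) u _ = _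
    rw [fderiv_clm_apply hd (differentiableAt_const _)]
    simp
  rw [key, key, hs.eq]

theorem fderiv_eq_sum_pd (f : EuclideanSpace ℝ (Fin m) → G) (u w : EuclideanSpace ℝ (Fin m)) :
    fderiv ℝ f u w = ∑ i, w i • pd i f u := by
  conv_lhs => rw [← (EuclideanSpace.basisFun (Fin m) ℝ).sum_repr w]
  simp [pd]

theorem contDiffOn_det {A : EuclideanSpace ℝ (Fin m) → Matrix (Fin m) (Fin m) ℝ}
    (hA : ∀ i j, ContDiffOn ℝ ∞ (fun y => A y i j) U) :
    ContDiffOn ℝ ∞ (fun y => (A y).det) U := by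
  simp only [Matrix.det_apply]
  exact ContDiffOn.sum fun σ _ => (contDiffOn_prod fun i _ => hA _ _).const_smul _

/-- Cramer's rule: the entries are polynomials in the entries of `A` divided by the determinant. -/
theorem contDiffOn_inv {A : EuclideanSpace ℝ (Fin m) → Matrix (Fin m) (Fin m) ℝ}
    (hA : ∀ i j, ContDiffOn ℝ ∞ (fun y => A y i j) U) (hdet : ∀ y ∈ U, (A y).det ≠ 0)
    (i j : Fin m) : ContDiffOn ℝ ∞ (fun y => (A y)⁻¹ i j) U := by
  simp only [Matrix.inv_def, Ring.inverse_eq_inv', Matrix.smul_apply, Matrix.adjugate_apply,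
    smul_eq_mul]
  refine ((contDiffOn_det hA).inv hdet).mul (contDiffOn_det fun a b => ?_)
  simp only [Matrix.updateRow_apply]
  split_ifs
  · exact contDiffOn_const
  · exact hA _ _

end PartialDerivatives

/-! ### Curvature of the unit sphere. -/

section SphereCurvature

variable {W : Type*} [NormedAddCommGroup W] [InnerProductSpace ℝ W]

theorem hasFDerivAt_tangentExt (x p : W) :
    HasFDerivAt (tangentExt x)
      (-(⟪p, x⟫ • ContinuousLinearMap.id ℝ W + (innerSL ℝ x).smulRight p)) p := by
  have h1 : HasFDerivAt (fun q : W => ⟪q, x⟫) (innerSL ℝ x) p := by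
    have := (innerSL ℝ x).hasFDerivAt (x := p)
    refine this.congr_of_eventuallyEq (Filter.Eventually.of_forall fun q => ?_)
    simp [real_inner_comm]
  have := (h1.smul (hasFDerivAt_id p)).const_sub x
  exact this

theorem fderiv_tangentExt (x p v : W) :
    fderiv ℝ (tangentExt x) p v = -(⟪p, x⟫ • v) - ⟪v, x⟫ • p := by
  rw [(hasFDerivAt_tangentExt x p).fderiv]
  simp [real_inner_comm]
  abel

theorem sphereConn_tangentExt (y z q : W) :
    sphereConn (tangentExt y) (tangentExt z) q =
      tangentProj q (-(⟪q, z⟫ • tangentExt y q) - ⟪tangentExt y q, z⟫ • q) := by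
  rw [sphereConn, fderiv_tangentExt]

/-- Along the sphere the differentiated field is `-⟪q, z⟫` times the extension of `y`. The factor
`⟪q, z⟫` vanishes at `p`, so only its derivative `⟪x, z⟫` survives. -/
theorem fderiv_sphereConn_tangentExt {p x y z : W} (hp : ‖p‖ = 1) (hx : ⟪p, x⟫ = 0)
    (hy : ⟪p, y⟫ = 0) (hz : ⟪p, z⟫ = 0) :
    fderiv ℝ (sphereConn (tangentExt y) (tangentExt z)) p x = -(⟪x, z⟫ • y) := by
  have hY := hasFDerivAt_tangentExt y p
  have hYp : tangentExt y p = y := by simp [tangentExt, tangentProj, hy]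
  have hid := hasFDerivAt_id (𝕜 := ℝ) p
  have hw := (((hid.inner ℝ (hasFDerivAt_const z p)).smul hY).neg).sub
    ((hY.inner ℝ (hasFDerivAt_const z p)).smul hid)
  have hG := hw.sub ((hid.inner ℝ hw).smul hid)
  have e : sphereConn (tangentExt y) (tangentExt z) = fun q =>
      (-(⟪q, z⟫ • tangentExt y q) - ⟪tangentExt y q, z⟫ • q) -
      ⟪q, (-(⟪q, z⟫ • tangentExt y q) - ⟪tangentExt y q, z⟫ • q)⟫ • q := by
    funext q
    rw [sphereConn_tangentExt, tangentProj]
  rw [e]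
  refine (congrArg (fun T : W →L[ℝ] W => T x) hG.fderiv).trans ?_
  have hx' : ⟪x, p⟫ = 0 := by rw [real_inner_comm, hx]
  simp [fderivInnerCLM_apply, hYp, hx, hy, hz, hx', inner_sub_right, inner_smul_right,
    inner_neg_right, inner_neg_left, inner_smul_left, hp]

/-- The unit sphere has constant curvature one. -/
theorem sphereCurvature_eq {p x y z : W} (hp : ‖p‖ = 1) (hx : ⟪p, x⟫ = 0)
    (hy : ⟪p, y⟫ = 0) (hz : ⟪p, z⟫ = 0) :
    sphereCurvature p x y z = ⟪y, z⟫ • x - ⟪x, z⟫ • y := by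
  have hX : ∀ {w : W}, ⟪p, w⟫ = 0 → tangentExt w p = w := fun {w} hw => by
    simp [tangentExt, tangentProj, hw]
  have hb : VectorField.lieBracket ℝ (tangentExt x) (tangentExt y) p = 0 := by
    rw [VectorField.lieBracket, fderiv_tangentExt, fderiv_tangentExt, hX hx, hX hy, hx, hy,
      real_inner_comm]
    simp
  have hc : ∀ (X Y : W → W) (q : W), sphereConn X Y q = tangentProj q (fderiv ℝ Y q (X q)) :=
    fun _ _ _ => rfl
  rw [sphereCurvature, hc (tangentExt x), hc (tangentExt y), hc (VectorField.lieBracket ℝ _ _),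
    hX hx, hX hy, hb, fderiv_sphereConn_tangentExt hp hx hy hz,
    fderiv_sphereConn_tangentExt hp hy hx hz]
  simp [tangentProj, inner_smul_right, hx, hy]
  abel

end SphereCurvature

/-! ### Local hypersurface theory: Gauss formula, Codazzi equation, trace of `∇h`. -/

section LocalHypersurface

variable {m : ℕ}

/-- A smooth immersion `F` of the open set `U` into the unit sphere, with unit normal `N`. -/
structure IsLocalHypersurface (F N : EuclideanSpace ℝ (Fin m) → Ambient m)
    (U : Set (EuclideanSpace ℝ (Fin m))) : Prop where
  isOpen : IsOpen U
  contDiffOn : ContDiffOn ℝ ∞ F U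
  contDiffOn_normal : ContDiffOn ℝ ∞ N U
  norm_eq_one : ∀ u ∈ U, ‖F u‖ = 1
  norm_normal : ∀ u ∈ U, ‖N u‖ = 1
  inner_normal : ∀ u ∈ U, ⟪F u, N u⟫ = 0
  inner_pd_normal : ∀ u ∈ U, ∀ i, ⟪pd i F u, N u⟫ = 0
  injective : ∀ u ∈ U, Function.Injective (fderiv ℝ F u)

/-- The coefficients `h_{ij} = -⟪∂_i F, ∂_j N⟫` of the second fundamental form. -/
def shapeForm (F N : EuclideanSpace ℝ (Fin m) → Ambient m) (u : EuclideanSpace ℝ (Fin m)) :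
    Matrix (Fin m) (Fin m) ℝ :=
  Matrix.of fun i j => -⟪pd i F u, pd j N u⟫

/-- The mean curvature function `(1 / m) g^{ij} h_{ij}` with respect to the normal `N`. -/
def scalarMeanCurvature (F N : EuclideanSpace ℝ (Fin m) → Ambient m)
    (u : EuclideanSpace ℝ (Fin m)) : ℝ :=
  (1 / (m : ℝ)) * ∑ i, ∑ j, (inducedMetric F u)⁻¹ i j * shapeForm F N u i j

/-- The covariant derivative `∇_i h_{jk}` of the second fundamental form. -/
def covDerivShape (F N : EuclideanSpace ℝ (Fin m) → Ambient m)
    (i j k : Fin m) (u : EuclideanSpace ℝ (Fin m)) : ℝ :=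
  pd i (fun y => shapeForm F N y j k) u - ∑ l, christoffel F i j l u * shapeForm F N u l k
    - ∑ l, christoffel F i k l u * shapeForm F N u j l

theorem inducedMetric_apply (F : EuclideanSpace ℝ (Fin m) → Ambient m)
    (u : EuclideanSpace ℝ (Fin m)) (i j : Fin m) :
    inducedMetric F u i j = ⟪pd i F u, pd j F u⟫ := rfl

theorem shapeForm_apply (F N : EuclideanSpace ℝ (Fin m) → Ambient m)
    (u : EuclideanSpace ℝ (Fin m)) (i j : Fin m) :
    shapeForm F N u i j = -⟪pd i F u, pd j N u⟫ := rfl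

theorem inducedMetric_symm (F : EuclideanSpace ℝ (Fin m) → Ambient m)
    (u : EuclideanSpace ℝ (Fin m)) (i j : Fin m) :
    inducedMetric F u i j = inducedMetric F u j i := by
  rw [inducedMetric_apply, inducedMetric_apply, real_inner_comm]

theorem inv_inducedMetric_symm (F : EuclideanSpace ℝ (Fin m) → Ambient m)
    (u : EuclideanSpace ℝ (Fin m)) (i j : Fin m) :
    (inducedMetric F u)⁻¹ i j = (inducedMetric F u)⁻¹ j i := by
  have h : (inducedMetric F u).transpose = inducedMetric F u := by
    ext a b
    exact inducedMetric_symm F u b a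
  have h2 : ((inducedMetric F u)⁻¹).transpose = (inducedMetric F u)⁻¹ := by
    rw [Matrix.transpose_nonsing_inv, h]
  conv_lhs => rw [← h2]
  rfl

theorem linearIndependent_pd {F : EuclideanSpace ℝ (Fin m) → Ambient m}
    {u : EuclideanSpace ℝ (Fin m)} (h : Function.Injective (fderiv ℝ F u)) :
    LinearIndependent ℝ fun i => pd i F u := by
  have := (EuclideanSpace.basisFun (Fin m) ℝ).toBasis.linearIndependent.map'
    (fderiv ℝ F u).toLinearMap (LinearMap.ker_eq_bot.2 h)
  have e : (fun i => pd i F u) =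
      (fderiv ℝ F u).toLinearMap ∘ (EuclideanSpace.basisFun (Fin m) ℝ).toBasis := by
    ext1 i
    simp [pd]
  rw [e]
  exact this

theorem inducedMetric_posDef {F : EuclideanSpace ℝ (Fin m) → Ambient m}
    {u : EuclideanSpace ℝ (Fin m)} (h : Function.Injective (fderiv ℝ F u)) :
    (inducedMetric F u).PosDef :=
  Matrix.posDef_gram_of_linearIndependent (𝕜 := ℝ) (linearIndependent_pd h)

namespace IsLocalHypersurface

variable {F N : EuclideanSpace ℝ (Fin m) → Ambient m} {U : Set (EuclideanSpace ℝ (Fin m))}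
  {u : EuclideanSpace ℝ (Fin m)}

theorem contDiffOn_inducedMetric (h : IsLocalHypersurface F N U) (i j : Fin m) :
    ContDiffOn ℝ ∞ (fun y => inducedMetric F y i j) U :=
  (contDiffOn_pd h.isOpen h.contDiffOn i).inner ℝ (contDiffOn_pd h.isOpen h.contDiffOn j)

theorem contDiffOn_shapeForm (h : IsLocalHypersurface F N U) (i j : Fin m) :
    ContDiffOn ℝ ∞ (fun y => shapeForm F N y i j) U :=
  ((contDiffOn_pd h.isOpen h.contDiffOn i).inner ℝ
    (contDiffOn_pd h.isOpen h.contDiffOn_normal j)).neg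

theorem isUnit_det (h : IsLocalHypersurface F N U) (hu : u ∈ U) :
    IsUnit (inducedMetric F u).det :=
  (inducedMetric_posDef (h.injective u hu)).det_pos.ne'.isUnit

theorem contDiffOn_inv_inducedMetric (h : IsLocalHypersurface F N U) (i j : Fin m) :
    ContDiffOn ℝ ∞ (fun y => (inducedMetric F y)⁻¹ i j) U :=
  contDiffOn_inv h.contDiffOn_inducedMetric (fun _ hy => (h.isUnit_det hy).ne_zero) i j

theorem contDiffOn_scalarMeanCurvature (h : IsLocalHypersurface F N U) :
    ContDiffOn ℝ ∞ (scalarMeanCurvature F N) U :=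
  contDiffOn_const.mul (ContDiffOn.sum fun i _ => ContDiffOn.sum fun j _ =>
    (h.contDiffOn_inv_inducedMetric i j).mul (h.contDiffOn_shapeForm i j))

theorem sum_inv_mul (h : IsLocalHypersurface F N U) (hu : u ∈ U) (i k : Fin m) :
    ∑ j, (inducedMetric F u)⁻¹ i j * inducedMetric F u j k = if i = k then 1 else 0 := by
  rw [← Matrix.mul_apply, Matrix.nonsing_inv_mul _ (h.isUnit_det hu), Matrix.one_apply]

theorem inner_pd_self (h : IsLocalHypersurface F N U) (hu : u ∈ U) (i : Fin m) :
    ⟪F u, pd i F u⟫ = 0 := by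
  have hF := differentiableAt_of_contDiffOn h.isOpen h.contDiffOn hu
  have h1 := pd_congr (f := fun y => ⟪F y, F y⟫) (g := fun _ => (1 : ℝ)) h.isOpen
    (fun y hy => by simp [h.norm_eq_one y hy]) hu i
  rw [pd_inner hF hF, pd_const, real_inner_comm (F u)] at h1
  linarith [real_inner_comm (F u) (pd i F u)]

theorem inner_normal_pd_normal (h : IsLocalHypersurface F N U) (hu : u ∈ U) (i : Fin m) :
    ⟪N u, pd i N u⟫ = 0 := by
  have hF := differentiableAt_of_contDiffOn h.isOpen h.contDiffOn_normal hu
  have h1 := pd_congr (f := fun y => ⟪N y, N y⟫) (g := fun _ => (1 : ℝ)) h.isOpen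
    (fun y hy => by simp [h.norm_normal y hy]) hu i
  rw [pd_inner hF hF, pd_const] at h1
  linarith [real_inner_comm (N u) (pd i N u)]

theorem inner_pd_normal_self (h : IsLocalHypersurface F N U) (hu : u ∈ U) (i : Fin m) :
    ⟪F u, pd i N u⟫ = 0 := by
  have hF := differentiableAt_of_contDiffOn h.isOpen h.contDiffOn hu
  have hN := differentiableAt_of_contDiffOn h.isOpen h.contDiffOn_normal hu
  have h1 := pd_congr (f := fun y => ⟪F y, N y⟫) (g := fun _ => (0 : ℝ)) h.isOpen
    (fun y hy => by simp [h.inner_normal y hy]) hu i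
  rw [pd_inner hF hN, pd_const, h.inner_pd_normal u hu] at h1
  linarith

/-- Differentiate `⟪∂_i F, N⟫ = 0`. In this form the symmetry of `h` is that of second derivatives.
-/
theorem shapeForm_eq (h : IsLocalHypersurface F N U) (hu : u ∈ U) (i j : Fin m) :
    shapeForm F N u i j = ⟪pd j (pd i F) u, N u⟫ := by
  have hF := differentiableAt_of_contDiffOn h.isOpen (contDiffOn_pd h.isOpen h.contDiffOn i) hu
  have hN := differentiableAt_of_contDiffOn h.isOpen h.contDiffOn_normal hu
  have h1 := pd_congr (f := fun y => ⟪pd i F y, N y⟫) (g := fun _ => (0 : ℝ)) h.isOpen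
    (fun y hy => by simp [h.inner_pd_normal y hy]) hu j
  rw [pd_inner hF hN, pd_const] at h1
  rw [shapeForm_apply]
  linarith

theorem shapeForm_symm (h : IsLocalHypersurface F N U) (hu : u ∈ U) (i j : Fin m) :
    shapeForm F N u i j = shapeForm F N u j i := by
  rw [h.shapeForm_eq hu, h.shapeForm_eq hu, pd_pd_comm h.isOpen h.contDiffOn hu]

theorem inner_pd_pd_self (h : IsLocalHypersurface F N U) (hu : u ∈ U) (i j : Fin m) :
    ⟪pd i (pd j F) u, F u⟫ = -inducedMetric F u i j := by
  have hF := differentiableAt_of_contDiffOn h.isOpen h.contDiffOn hu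
  have hF' := differentiableAt_of_contDiffOn h.isOpen (contDiffOn_pd h.isOpen h.contDiffOn j) hu
  have h1 := pd_congr (f := fun y => ⟪F y, pd j F y⟫) (g := fun _ => (0 : ℝ)) h.isOpen
    (fun y hy => by simp [h.inner_pd_self hy]) hu i
  rw [pd_inner hF hF', pd_const] at h1
  rw [inducedMetric_apply]
  linarith [real_inner_comm (F u) (pd i (pd j F) u)]

/-- A vector orthogonal to the hypersurface, to its normal and to the position vector vanishes. -/
theorem eq_zero_of_inner_eq_zero (h : IsLocalHypersurface F N U) (hu : u ∈ U) {X : Ambient m}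
    (hT : ∀ i, ⟪X, pd i F u⟫ = 0) (hN : ⟪X, N u⟫ = 0) (hF : ⟪X, F u⟫ = 0) : X = 0 := by
  by_contra hX
  let b : Option (Option (Option (Fin m))) → Ambient m
    | none => X
    | some none => N u
    | some (some none) => F u
    | some (some (some i)) => pd i F u
  -- If `X ≠ 0`, then `X`, `N`, `F` and the `m` tangent vectors are `m + 3` independent vectors in a
  -- space of dimension `m + 2`.
  have hli : LinearIndependent ℝ b := by
    rw [Fintype.linearIndependent_iff]
    intro c hc
    simp only [Fintype.sum_option, b] at hc
    have e1 := congrArg (fun y => ⟪X, y⟫) hc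
    have e2 := congrArg (fun y => ⟪N u, y⟫) hc
    have e3 := congrArg (fun y => ⟪F u, y⟫) hc
    simp only [inner_add_right, inner_smul_right, inner_sum, hT, hN, hF,
      real_inner_self_eq_norm_sq, real_inner_comm X, real_inner_comm (F u) (N u),
      h.inner_normal u hu, h.norm_eq_one u hu, h.norm_normal u hu, h.inner_pd_self hu,
      real_inner_comm (pd _ F u) (N u), h.inner_pd_normal u hu, inner_zero_right] at e1 e2 e3
    have c1 : c none = 0 := by simpa [hX] using e1
    have c2 : c (some none) = 0 := by simpa using e2
    have c3 : c (some (some none)) = 0 := by simpa using e3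
    have hc' : ∑ i, c (some (some (some i))) • pd i F u = 0 := by simpa [c1, c2, c3] using hc
    have c4 := Fintype.linearIndependent_iff.1 (linearIndependent_pd (h.injective u hu)) _ hc'
    rintro (_ | _ | _ | i)
    · exact c1
    · exact c2
    · exact c3
    · exact c4 i
  have := hli.fintype_card_le_finrank
  simp at this

theorem ext_inner (h : IsLocalHypersurface F N U) (hu : u ∈ U) {X Y : Ambient m}
    (hT : ∀ i, ⟪X, pd i F u⟫ = ⟪Y, pd i F u⟫) (hN : ⟪X, N u⟫ = ⟪Y, N u⟫)
    (hF : ⟪X, F u⟫ = ⟪Y, F u⟫) : X = Y :=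
  sub_eq_zero.1 <| h.eq_zero_of_inner_eq_zero hu
    (fun i => by rw [inner_sub_left, hT, sub_self]) (by rw [inner_sub_left, hN, sub_self])
    (by rw [inner_sub_left, hF, sub_self])

theorem pd_inducedMetric (h : IsLocalHypersurface F N U) (hu : u ∈ U) (k i j : Fin m) :
    pd k (fun y => inducedMetric F y i j) u =
      ⟪pd i F u, pd k (pd j F) u⟫ + ⟪pd k (pd i F) u, pd j F u⟫ :=
  pd_inner (differentiableAt_of_contDiffOn h.isOpen (contDiffOn_pd h.isOpen h.contDiffOn i) hu)
    (differentiableAt_of_contDiffOn h.isOpen (contDiffOn_pd h.isOpen h.contDiffOn j) hu) k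

/-- By the product rule, and since second derivatives commute, four of the six terms in the metric
formula cancel and the other two coincide. -/
theorem christoffel_eq (h : IsLocalHypersurface F N U) (hu : u ∈ U) (i j k : Fin m) :
    christoffel F i j k u =
      ∑ l, (inducedMetric F u)⁻¹ k l * ⟪pd i (pd j F) u, pd l F u⟫ := by
  rw [christoffel, Finset.mul_sum]
  refine Finset.sum_congr rfl fun l _ => ?_
  rw [h.pd_inducedMetric hu, h.pd_inducedMetric hu, h.pd_inducedMetric hu,
    pd_pd_comm h.isOpen h.contDiffOn hu l j, pd_pd_comm h.isOpen h.contDiffOn hu l i,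
    pd_pd_comm h.isOpen h.contDiffOn hu j i,
    real_inner_comm (pd j F u) (pd i (pd l F) u)]
  ring

theorem sum_christoffel_mul (h : IsLocalHypersurface F N U) (hu : u ∈ U) (i j l : Fin m) :
    ∑ k, christoffel F i j k u * inducedMetric F u k l = ⟪pd i (pd j F) u, pd l F u⟫ := by
  simp only [h.christoffel_eq hu, Finset.sum_mul]
  rw [Finset.sum_comm]
  have : ∀ a k, (inducedMetric F u)⁻¹ k a * ⟪pd i (pd j F) u, pd a F u⟫ * inducedMetric F u k l =
      ⟪pd i (pd j F) u, pd a F u⟫ * ((inducedMetric F u)⁻¹ a k * inducedMetric F u k l) := by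
    intro a k
    rw [inv_inducedMetric_symm]
    ring
  simp only [this, ← Finset.mul_sum, h.sum_inv_mul hu]
  simp

/-- The Gauss formula. -/
theorem pd_pd_eq (h : IsLocalHypersurface F N U) (hu : u ∈ U) (i j : Fin m) :
    pd i (pd j F) u = ∑ k, christoffel F i j k u • pd k F u + shapeForm F N u i j • N u
      - inducedMetric F u i j • F u := by
  apply h.ext_inner hu
  · intro l
    simp only [inner_add_left, inner_sub_left, sum_inner, inner_smul_left, h.inner_pd_self hu,
      real_inner_comm (pd l F u) (N u), h.inner_pd_normal u hu, ← inducedMetric_apply]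
    simp [h.sum_christoffel_mul hu]
  · simp only [inner_add_left, inner_sub_left, sum_inner, inner_smul_left,
      h.inner_pd_normal u hu, h.inner_normal u hu, real_inner_self_eq_norm_sq, h.norm_normal u hu]
    rw [h.shapeForm_symm hu, h.shapeForm_eq hu]
    simp
  · simp only [inner_add_left, inner_sub_left, sum_inner, inner_smul_left,
      real_inner_comm (F u) (pd _ F u), h.inner_pd_self hu, real_inner_comm (F u) (N u),
      h.inner_normal u hu, real_inner_self_eq_norm_sq, h.norm_eq_one u hu, h.inner_pd_pd_self hu]
    simp

/-- In the Gauss formula the projection removes the radial part and the Christoffel sum the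
tangential one. -/
theorem secondFundForm_eq (h : IsLocalHypersurface F N U) (hu : u ∈ U) (i j : Fin m) :
    secondFundForm F i j u = shapeForm F N u i j • N u := by
  rw [secondFundForm, covDeriv, tangentProj, real_inner_comm (pd i (pd j F) u),
    h.inner_pd_pd_self hu, h.pd_pd_eq hu]
  module

theorem localMeanCurvature_eq (h : IsLocalHypersurface F N U) (hu : u ∈ U) :
    localMeanCurvature F u = scalarMeanCurvature F N u • N u := by
  simp only [localMeanCurvature, scalarMeanCurvature, h.secondFundForm_eq hu, smul_smul,
    ← Finset.sum_smul]

/-- The Weingarten formula, paired with a covariant second derivative of the immersion. -/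
theorem inner_pd_pd_pd_normal (h : IsLocalHypersurface F N U) (hu : u ∈ U) (i j k : Fin m) :
    ⟪pd j (pd k F) u, pd i N u⟫ = -∑ l, christoffel F j k l u * shapeForm F N u l i := by
  rw [h.pd_pd_eq hu]
  simp only [inner_add_left, inner_sub_left, sum_inner, inner_smul_left,
    h.inner_normal_pd_normal hu, h.inner_pd_normal_self hu, shapeForm_apply]
  simp

theorem pd_shapeForm (h : IsLocalHypersurface F N U) (hu : u ∈ U) (i j k : Fin m) :
    pd i (fun y => shapeForm F N y j k) u =
      ⟪pd i (pd j (pd k F)) u, N u⟫ - ∑ l, christoffel F j k l u * shapeForm F N u l i := by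
  have e := pd_congr (f := fun y => shapeForm F N y j k)
    (g := fun y => ⟪pd j (pd k F) y, N y⟫) h.isOpen
    (fun y hy => by simp only [h.shapeForm_symm hy j k, h.shapeForm_eq hy]) hu i
  rw [e, pd_inner (differentiableAt_of_contDiffOn h.isOpen
      (contDiffOn_pd h.isOpen (contDiffOn_pd h.isOpen h.contDiffOn k) j) hu)
    (differentiableAt_of_contDiffOn h.isOpen h.contDiffOn_normal hu),
    h.inner_pd_pd_pd_normal hu]
  ring

/-- The Codazzi equation. -/
theorem codazzi (h : IsLocalHypersurface F N U) (hu : u ∈ U) (i j k : Fin m) :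
    covDerivShape F N i j k u = covDerivShape F N k i j u := by
  have hc : ∀ a b l, christoffel F a b l u = christoffel F b a l u := fun a b l => by
    simp only [h.christoffel_eq hu, pd_pd_comm h.isOpen h.contDiffOn hu a b]
  -- The third derivatives of `F` agree under permutation; the Christoffel terms that remain match
  -- by symmetry.
  have h3 : pd i (pd j (pd k F)) u = pd k (pd i (pd j F)) u := by
    rw [pd_pd_comm h.isOpen (contDiffOn_pd h.isOpen h.contDiffOn j) hu k i]
    exact pd_congr h.isOpen (fun y hy => pd_pd_comm h.isOpen h.contDiffOn hy j k) hu i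
  simp only [covDerivShape, h.pd_shapeForm hu, h3, hc k i, hc k j]
  simp only [h.shapeForm_symm hu j, h.shapeForm_symm hu i]
  ring

/-- This is `∇g⁻¹ = 0`. Differentiate `g⁻¹ g = 1` and insert metric compatibility, `∂_k g = C g + g
Cᵀ` with `C` the matrix of Christoffel symbols. -/
theorem pd_inv_inducedMetric (h : IsLocalHypersurface F N U) (hu : u ∈ U) (k i j : Fin m) :
    pd k (fun y => (inducedMetric F y)⁻¹ i j) u =
      -∑ l, (inducedMetric F u)⁻¹ i l * christoffel F k l j u
      - ∑ l, christoffel F k l i u * (inducedMetric F u)⁻¹ l j := by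
  set a := (inducedMetric F u)⁻¹ with ha
  set g := inducedMetric F u with hg
  let A : Matrix (Fin m) (Fin m) ℝ :=
    Matrix.of fun i j => pd k (fun y => (inducedMetric F y)⁻¹ i j) u
  let D : Matrix (Fin m) (Fin m) ℝ := Matrix.of fun i j => pd k (fun y => inducedMetric F y i j) u
  let C : Matrix (Fin m) (Fin m) ℝ := Matrix.of fun i l => christoffel F k i l u
  have hga : g * a = 1 := Matrix.mul_nonsing_inv _ (h.isUnit_det hu)
  have hag : a * g = 1 := Matrix.nonsing_inv_mul _ (h.isUnit_det hu)
  have hAg : A * g + a * D = 0 := by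
    ext p q
    have e := pd_congr (f := fun y => ∑ l, (inducedMetric F y)⁻¹ p l * inducedMetric F y l q)
      (g := fun _ => if p = q then (1 : ℝ) else 0) h.isOpen (fun y hy => h.sum_inv_mul hy p q) hu k
    have da := fun l =>
      differentiableAt_of_contDiffOn h.isOpen (h.contDiffOn_inv_inducedMetric p l) hu
    have dg := fun l =>
      differentiableAt_of_contDiffOn h.isOpen (h.contDiffOn_inducedMetric l q) hu
    rw [pd_const, pd_sum _ fun l _ => (da l).fun_mul (dg l)] at e
    simp only [pd_mul (da _) (dg _), Finset.sum_add_distrib] at e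
    simpa [Matrix.add_apply, Matrix.mul_apply, A, D] using e
  have hD : D = C * g + g * C.transpose := by
    ext p q
    simp only [D, Matrix.of_apply, h.pd_inducedMetric hu, Matrix.add_apply, Matrix.mul_apply, C,
      Matrix.transpose_apply]
    rw [real_inner_comm, ← h.sum_christoffel_mul hu k q p, ← h.sum_christoffel_mul hu k p q,
      add_comm]
    congr 1
    exact Finset.sum_congr rfl fun l _ => by rw [inducedMetric_symm F u l p, mul_comm]
  have hA : A = -(a * C) - C.transpose * a := by
    have h1 : A = A * g * a := by rw [Matrix.mul_assoc, hga, Matrix.mul_one]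
    rw [h1, eq_neg_of_add_eq_zero_left hAg, hD, Matrix.mul_add, ← Matrix.mul_assoc a g, hag,
      Matrix.one_mul, Matrix.neg_mul, Matrix.add_mul, Matrix.mul_assoc, Matrix.mul_assoc, hga,
      Matrix.mul_one]
    abel
  have := congrFun (congrFun hA i) j
  simpa [A, C, Matrix.mul_apply] using this

/-- The derivative of the mean curvature is the trace of `∇h`. -/
theorem sum_covDerivShape (h : IsLocalHypersurface F N U) (hu : u ∈ U) (hm : (m : ℝ) ≠ 0)
    (k : Fin m) :
    ∑ i, ∑ j, (inducedMetric F u)⁻¹ i j * covDerivShape F N k i j u =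
      m * pd k (scalarMeanCurvature F N) u := by
  have da := fun i j =>
    differentiableAt_of_contDiffOn h.isOpen (h.contDiffOn_inv_inducedMetric i j) hu
  have dh := fun i j => differentiableAt_of_contDiffOn h.isOpen (h.contDiffOn_shapeForm i j) hu
  have e : pd k (scalarMeanCurvature F N) u = (1 / (m : ℝ)) * ∑ i, ∑ j,
      (pd k (fun y => (inducedMetric F y)⁻¹ i j) u * shapeForm F N u i j +
        (inducedMetric F u)⁻¹ i j * pd k (fun y => shapeForm F N y i j) u) := by
    have d1 := fun i j => (da i j).fun_mul (dh i j)
    have d2 := fun i => DifferentiableAt.fun_sum (u := Finset.univ) fun j _ => d1 i j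
    change pd k (fun y => (1 / (m : ℝ)) * ∑ i, ∑ j,
      (inducedMetric F y)⁻¹ i j * shapeForm F N y i j) u = _
    rw [pd_mul (differentiableAt_const _) (DifferentiableAt.fun_sum fun i _ => d2 i), pd_const,
      pd_sum _ fun i _ => d2 i, zero_mul, zero_add]
    congr 1
    refine Finset.sum_congr rfl fun i _ => ?_
    rw [pd_sum _ fun j _ => d1 i j]
    exact Finset.sum_congr rfl fun j _ => pd_mul (da i j) (dh i j) k
  rw [e, ← mul_assoc, mul_one_div_cancel hm, one_mul]
  simp only [h.pd_inv_inducedMetric hu, covDerivShape, sub_mul, neg_mul, mul_sub,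
    Finset.sum_add_distrib, Finset.sum_sub_distrib, Finset.sum_neg_distrib, Finset.sum_mul,
    Finset.mul_sum]
  -- After renaming indices, the Christoffel terms from `∂_k g⁻¹` are exactly those in `∇_k h`.
  have s1 : ∀ i, ∑ j, ∑ l, (inducedMetric F u)⁻¹ i l * christoffel F k l j u * shapeForm F N u i j =
      ∑ j, ∑ l, (inducedMetric F u)⁻¹ i j * (christoffel F k j l u * shapeForm F N u i l) := by
    intro i
    rw [Finset.sum_comm]
    simp only [mul_assoc]
  have s2 : ∑ i, ∑ j, ∑ l, christoffel F k l i u * (inducedMetric F u)⁻¹ l j * shapeForm F N u i j =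
      ∑ i, ∑ j, ∑ l, (inducedMetric F u)⁻¹ i j * (christoffel F k i l u * shapeForm F N u l j) := by
    simp only [fun i => Finset.sum_comm (s := Finset.univ) (t := Finset.univ)
      (f := fun j l => christoffel F k l i u * (inducedMetric F u)⁻¹ l j * shapeForm F N u i j)]
    rw [Finset.sum_comm]
    refine Finset.sum_congr rfl fun i _ => ?_
    rw [Finset.sum_comm]
    exact Finset.sum_congr rfl fun j _ => Finset.sum_congr rfl fun l _ => by ring
  simp only [s1, s2]
  ring

end IsLocalHypersurface

end LocalHypersurface

/-! ### Tangential part of the biharmonic equation. -/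

section LocalBiharmonic

variable {m : ℕ}

namespace IsLocalHypersurface

variable {F N : EuclideanSpace ℝ (Fin m) → Ambient m} {U : Set (EuclideanSpace ℝ (Fin m))}
  {u : EuclideanSpace ℝ (Fin m)}

/-- Both `N` and `∂_j N` are orthogonal to `F`, so the projection changes nothing. -/
theorem covDeriv_localMeanCurvature (h : IsLocalHypersurface F N U) (hu : u ∈ U) (j : Fin m) :
    covDeriv F j (localMeanCurvature F) u =
      pd j (scalarMeanCurvature F N) u • N u + scalarMeanCurvature F N u • pd j N u := by
  rw [covDeriv, pd_congr h.isOpen (fun y hy => h.localMeanCurvature_eq hy) hu,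
    pd_smul (differentiableAt_of_contDiffOn h.isOpen h.contDiffOn_scalarMeanCurvature hu)
      (differentiableAt_of_contDiffOn h.isOpen h.contDiffOn_normal hu), tangentProj,
    inner_add_right, inner_smul_right, inner_smul_right, h.inner_normal u hu,
    h.inner_pd_normal_self hu]
  simp

theorem inner_pd_pd_normal (h : IsLocalHypersurface F N U) (hu : u ∈ U) (i j k : Fin m) :
    ⟪pd i (pd j N) u, pd k F u⟫ =
      -pd i (fun y => shapeForm F N y k j) u
        + ∑ l, christoffel F i k l u * shapeForm F N u l j := by
  have e : pd i (fun y => shapeForm F N y k j) u = _ := pd_neg (fun y => ⟪pd k F y, pd j N y⟫) i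
  rw [e, pd_inner (differentiableAt_of_contDiffOn h.isOpen
      (contDiffOn_pd h.isOpen h.contDiffOn k) hu)
    (differentiableAt_of_contDiffOn h.isOpen (contDiffOn_pd h.isOpen h.contDiffOn_normal j) hu),
    h.inner_pd_pd_pd_normal hu, real_inner_comm]
  ring

theorem inner_covDeriv_covDeriv (h : IsLocalHypersurface F N U) (hu : u ∈ U) (i j k : Fin m) :
    ⟪covDeriv F i (covDeriv F j (localMeanCurvature F)) u
        - ∑ l, christoffel F i j l u • covDeriv F l (localMeanCurvature F) u, pd k F u⟫ =
      -(pd j (scalarMeanCurvature F N) u * shapeForm F N u k i)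
        - pd i (scalarMeanCurvature F N) u * shapeForm F N u k j
        - scalarMeanCurvature F N u * covDerivShape F N k j i u := by
  have hf := h.contDiffOn_scalarMeanCurvature
  have df := differentiableAt_of_contDiffOn h.isOpen hf hu
  have dN := differentiableAt_of_contDiffOn h.isOpen h.contDiffOn_normal hu
  have df' := differentiableAt_of_contDiffOn h.isOpen (contDiffOn_pd h.isOpen hf j) hu
  have dN' := differentiableAt_of_contDiffOn h.isOpen
    (contDiffOn_pd h.isOpen h.contDiffOn_normal j) hu
  have e1 : pd i (covDeriv F j (localMeanCurvature F)) u =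
      (pd i (pd j (scalarMeanCurvature F N)) u • N u
        + pd j (scalarMeanCurvature F N) u • pd i N u)
      + (pd i (scalarMeanCurvature F N) u • pd j N u
        + scalarMeanCurvature F N u • pd i (pd j N) u) := by
    rw [pd_congr h.isOpen (fun y hy => h.covDeriv_localMeanCurvature hy j) hu, ← pd_smul df' dN,
      ← pd_smul df dN']
    exact pd_add (df'.fun_smul dN) (df.fun_smul dN') i
  have hN : ⟪N u, pd k F u⟫ = 0 := by rw [real_inner_comm, h.inner_pd_normal u hu]
  have hN' : ∀ l, ⟪pd l N u, pd k F u⟫ = -shapeForm F N u k l := fun l => by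
    rw [shapeForm_apply, neg_neg, real_inner_comm]
  have e2 : ⟪covDeriv F i (covDeriv F j (localMeanCurvature F)) u, pd k F u⟫ =
      -(pd j (scalarMeanCurvature F N) u * shapeForm F N u k i)
        - pd i (scalarMeanCurvature F N) u * shapeForm F N u k j
        + scalarMeanCurvature F N u * (-pd i (fun y => shapeForm F N y k j) u
        + ∑ l, christoffel F i k l u * shapeForm F N u l j) := by
    rw [covDeriv, tangentProj, inner_sub_left, inner_smul_left, h.inner_pd_self hu, e1]
    simp only [inner_add_left, inner_smul_left, hN, hN', h.inner_pd_pd_normal hu]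
    simp
    ring
  have e3 : ∀ l, ⟪covDeriv F l (localMeanCurvature F) u, pd k F u⟫ =
      -(scalarMeanCurvature F N u * shapeForm F N u k l) := fun l => by
    rw [h.covDeriv_localMeanCurvature hu]
    simp only [inner_add_left, inner_smul_left, hN, hN']
    simp
  rw [inner_sub_left, e2, sum_inner]
  simp only [inner_smul_left, e3]
  -- The computation produces `∇_i h_{kj}`. Codazzi, used twice, puts `k` in the derivative slot, so
  -- that the later trace over `i, j` gives `m ∂_k f`.
  rw [← h.codazzi hu j i k, ← h.codazzi hu i k j, covDerivShape]
  have : ∑ l, (starRingEnd ℝ) (christoffel F i j l u)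
      * -(scalarMeanCurvature F N u * shapeForm F N u k l) =
      -(scalarMeanCurvature F N u * ∑ l, christoffel F i j l u * shapeForm F N u k l) := by
    rw [Finset.mul_sum, ← Finset.sum_neg_distrib]
    exact Finset.sum_congr rfl fun l _ => by simp; ring
  rw [this]
  ring

/-- The two terms pairing `df` with `h` have the same trace, since `g⁻¹` is symmetric; hence the
factor 2. -/
theorem inner_roughLaplacian (h : IsLocalHypersurface F N U) (hu : u ∈ U) (hm : (m : ℝ) ≠ 0)
    (k : Fin m) :
    ⟪roughLaplacian F (localMeanCurvature F) u, pd k F u⟫ =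
      2 * ∑ j, (∑ i, (inducedMetric F u)⁻¹ j i * pd i (scalarMeanCurvature F N) u)
        * shapeForm F N u k j
        + m * scalarMeanCurvature F N u * pd k (scalarMeanCurvature F N) u := by
  have hs := h.sum_covDerivShape hu hm k
  rw [Finset.sum_comm] at hs
  simp only [inv_inducedMetric_symm F u _ _] at hs
  rw [roughLaplacian, inner_neg_left, sum_inner]
  simp only [sum_inner, inner_smul_left, h.inner_covDeriv_covDeriv hu, mul_sub, mul_neg,
    Finset.sum_sub_distrib, Finset.sum_neg_distrib, conj_trivial]
  have s1 : ∑ i, ∑ j, (inducedMetric F u)⁻¹ i j *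
      (pd j (scalarMeanCurvature F N) u * shapeForm F N u k i) =
      ∑ j, (∑ i, (inducedMetric F u)⁻¹ j i * pd i (scalarMeanCurvature F N) u)
        * shapeForm F N u k j := by
    simp only [Finset.sum_mul, mul_assoc]
  have s2 : ∑ i, ∑ j, (inducedMetric F u)⁻¹ i j *
      (pd i (scalarMeanCurvature F N) u * shapeForm F N u k j) =
      ∑ j, (∑ i, (inducedMetric F u)⁻¹ j i * pd i (scalarMeanCurvature F N) u)
        * shapeForm F N u k j := by
    rw [Finset.sum_comm]
    simp only [Finset.sum_mul, mul_assoc]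
    exact Finset.sum_congr rfl fun j _ => Finset.sum_congr rfl fun i _ => by
      rw [inv_inducedMetric_symm]
  have s3 : ∑ i, ∑ j, (inducedMetric F u)⁻¹ i j *
      (scalarMeanCurvature F N u * covDerivShape F N k j i u) =
      m * scalarMeanCurvature F N u * pd k (scalarMeanCurvature F N) u := by
    rw [mul_right_comm, ← h.sum_covDerivShape hu hm k, Finset.sum_comm, Finset.sum_mul]
    refine Finset.sum_congr rfl fun j _ => ?_
    rw [Finset.sum_mul]
    exact Finset.sum_congr rfl fun i _ => by
      rw [inv_inducedMetric_symm]
      ring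
  rw [s1, s2, s3]
  ring

/-- As `H` is normal, constant curvature gives `R(∂_i F, H) ∂_j F = -g_{ij} H`, which is again
normal. -/
theorem inner_sum_sphereCurvature (h : IsLocalHypersurface F N U) (hu : u ∈ U) (k : Fin m) :
    ⟪∑ i, ∑ j, (inducedMetric F u)⁻¹ i j •
        sphereCurvature (F u) (pd i F u) (localMeanCurvature F u) (pd j F u), pd k F u⟫ = 0 := by
  have hN : ∀ j, ⟪N u, pd j F u⟫ = 0 := fun j => by
    rw [real_inner_comm, h.inner_pd_normal u hu]
  have e : ∀ i j, sphereCurvature (F u) (pd i F u) (localMeanCurvature F u) (pd j F u) =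
      -(⟪pd i F u, pd j F u⟫ • localMeanCurvature F u) := fun i j => by
    rw [sphereCurvature_eq (h.norm_eq_one u hu) (h.inner_pd_self hu i) _ (h.inner_pd_self hu j),
      h.localMeanCurvature_eq hu, inner_smul_left, hN, mul_zero, zero_smul, zero_sub]
    rw [h.localMeanCurvature_eq hu, inner_smul_right, h.inner_normal u hu, mul_zero]
  simp only [e, sum_inner, inner_smul_left, inner_neg_left]
  simp [h.localMeanCurvature_eq hu, inner_smul_left, hN]

/-- The gradient of the mean curvature of a biharmonic hypersurface is in the kernel of
`A + (m / 2) f`. -/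
theorem sum_shapeForm_mul_grad (h : IsLocalHypersurface F N U) (hu : u ∈ U) (hm : (m : ℝ) ≠ 0)
    (hb : localBitension F u = 0) (k : Fin m) :
    ∑ j, (∑ i, (inducedMetric F u)⁻¹ j i * pd i (scalarMeanCurvature F N) u)
        * shapeForm F N u k j =
      -(m / 2 * scalarMeanCurvature F N u) * pd k (scalarMeanCurvature F N) u := by
  rw [localBitension, neg_eq_zero, smul_eq_zero, or_iff_right hm] at hb
  have e := congrArg (fun y => ⟪y, pd k F u⟫) hb
  simp only [inner_add_left, h.inner_roughLaplacian hu hm, h.inner_sum_sphereCurvature hu,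
    inner_zero_left] at e
  linarith

end IsLocalHypersurface

end LocalBiharmonic

/-! ### Eigenvalues of symmetric pencils and continuous selections of them. -/

section Pencil

variable {m : ℕ}

open scoped MatrixOrder in
/-- A symmetric matrix is diagonalizable with respect to a positive definite one. -/
theorem exists_det_sub_smul_eq {g h : Matrix (Fin m) (Fin m) ℝ} (hg : g.PosDef)
    (hh : h.IsHermitian) :
    ∃ μ : Fin m → ℝ, ∀ κ : ℝ, (h - κ • g).det = g.det * ∏ i, (μ i - κ) := by
  -- Factoring `g = B* B` turns the pencil into an ordinary symmetric eigenvalue problem for `B⁻* h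
  -- B⁻¹`.
  obtain ⟨B, hB, rfl⟩ : ∃ B : Matrix (Fin m) (Fin m) ℝ, IsUnit B ∧ g = B.conjTranspose * B := by
    obtain ⟨B, rfl⟩ := CStarAlgebra.nonneg_iff_eq_star_mul_self.mp hg.posSemidef.nonneg
    refine ⟨B, (Matrix.isUnit_iff_isUnit_det B).2 (isUnit_iff_ne_zero.2 fun h0 => ?_), rfl⟩
    have := hg.det_pos
    rw [Matrix.det_mul, h0, mul_zero] at this
    exact lt_irrefl _ this
  have hBd : IsUnit B.det := (Matrix.isUnit_iff_isUnit_det B).1 hB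
  have hC : (B⁻¹.conjTranspose * h * B⁻¹).IsHermitian :=
    Matrix.isHermitian_conjTranspose_mul_mul _ hh
  refine ⟨hC.eigenvalues, fun κ => ?_⟩
  have e1 : h - κ • (B.conjTranspose * B) =
      B.conjTranspose * (B⁻¹.conjTranspose * h * B⁻¹ - κ • 1) * B := by
    have h1 : B.conjTranspose * B⁻¹.conjTranspose = 1 := by
      rw [← Matrix.conjTranspose_mul, Matrix.nonsing_inv_mul _ hBd, Matrix.conjTranspose_one]
    rw [Matrix.mul_sub, Matrix.sub_mul, ← Matrix.mul_assoc, ← Matrix.mul_assoc, h1,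
      Matrix.one_mul, Matrix.mul_assoc, Matrix.nonsing_inv_mul _ hBd, Matrix.mul_one,
      Matrix.mul_smul, Matrix.smul_mul, Matrix.mul_one]
  have e2 : (B⁻¹.conjTranspose * h * B⁻¹ - κ • 1).det = ∏ i, (hC.eigenvalues i - κ) := by
    have := congrArg (Polynomial.eval κ) hC.charpoly_eq
    rw [Matrix.eval_charpoly, Polynomial.eval_prod] at this
    rw [← neg_sub, Matrix.det_neg, Matrix.smul_one_eq_diagonal, ← Matrix.scalar_apply, this,
      ← Finset.card_univ, ← Finset.prod_const, ← Finset.prod_mul_distrib]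
    exact Finset.prod_congr rfl fun i _ => by simp
  rw [e1, Matrix.det_mul, Matrix.det_mul, e2, Matrix.det_mul]
  ring

/-- `κ` is an eigenvalue of `h` relative to `g` exactly when `det (h - κ g) = 0`. -/
theorem det_sub_smul_eq_zero_iff {g h : Matrix (Fin m) (Fin m) ℝ} {κ : ℝ} :
    (h - κ • g).det = 0 ↔
      ∃ w : Fin m → ℝ, w ≠ 0 ∧ ∀ i, ∑ j, h i j * w j = κ * ∑ j, g i j * w j := by
  rw [← Matrix.exists_mulVec_eq_zero_iff]
  refine exists_congr fun w => and_congr_right fun _ => ?_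
  rw [Matrix.sub_mulVec, Matrix.smul_mulVec, sub_eq_zero, funext_iff]
  rfl

/-- The eigenvalues of a family of pencils depend lower semicontinuously on the parameter. -/
theorem eventually_exists_det_sub_smul_eq_zero {X : Type*} [TopologicalSpace X]
    {g h : X → Matrix (Fin m) (Fin m) ℝ} {x₀ : X} (hgc : ContinuousAt g x₀)
    (hhc : ContinuousAt h x₀) (hg : ∀ᶠ x in nhds x₀, (g x).PosDef)
    (hh : ∀ᶠ x in nhds x₀, (h x).IsHermitian) {κ : ℝ} (hκ : (h x₀ - κ • g x₀).det = 0)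
    {ε : ℝ} (hε : 0 < ε) :
    ∀ᶠ x in nhds x₀, ∃ μ, |μ - κ| < ε ∧ (h x - μ • g x).det = 0 := by
  have h1 : ContinuousAt (fun x => (h x - κ • g x).det) x₀ :=
    (continuous_id.matrix_det.continuousAt).comp (hhc.sub (hgc.const_smul κ))
  have h2 : ContinuousAt (fun x => (g x).det * ε ^ m) x₀ :=
    ((continuous_id.matrix_det.continuousAt).comp hgc).mul continuousAt_const
  -- This strict inequality persists near `x₀`. If all `m` roots stayed at distance at least `ε`
  -- from `κ`, the factorization of the determinant would give the reverse one.
  have h3 : |(h x₀ - κ • g x₀).det| < (g x₀).det * ε ^ m := by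
    rw [hκ, abs_zero]
    exact mul_pos hg.self_of_nhds.det_pos (pow_pos hε m)
  filter_upwards [h1.abs.eventually_lt h2 h3, hg, hh] with x hx hgx hhx
  obtain ⟨μ, hμ⟩ := exists_det_sub_smul_eq hgx hhx
  by_contra! hcon
  have hlow : ∀ i, ε ≤ |μ i - κ| := fun i => by
    by_contra! hi
    refine hcon (μ i) hi ?_
    rw [hμ, Finset.prod_eq_zero (Finset.mem_univ i) (sub_self _), mul_zero]
  rw [hμ, abs_mul, abs_of_pos hgx.det_pos, Finset.abs_prod] at hx
  have := lt_of_mul_lt_mul_left hx hgx.det_pos.le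
  have h4 : ∏ _i : Fin m, ε ≤ ∏ i, |μ i - κ| :=
    Finset.prod_le_prod (fun _ _ => hε.le) fun i _ => hlow i
  rw [Finset.prod_const, Finset.card_univ, Fintype.card_fin] at h4
  exact absurd this (not_lt.2 h4)

/-- If near `x₀` every value of a strictly decreasing family is approximated by values of the
family, then a selection of values continuous at `x₀` is locally one of the members. -/
theorem eventually_eq_of_strictAnti {X : Type*} [TopologicalSpace X] {ℓ : ℕ}
    {k : Fin ℓ → X → ℝ} (hk : ∀ x, StrictAnti fun i => k i x) {x₀ : X}
    (hlow : ∀ i, ∀ ε > 0, ∀ᶠ x in nhds x₀, ∃ j, |k j x - k i x₀| < ε)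
    {κ : X → ℝ} (hκ : ContinuousAt κ x₀) (hmem : ∀ᶠ x in nhds x₀, ∃ i, k i x = κ x) :
    ∃ i, k i =ᶠ[nhds x₀] κ := by
  obtain ⟨i₀, hi₀⟩ := hmem.self_of_nhds
  refine ⟨i₀, ?_⟩
  -- With gaps above `2 ε`, values within `ε` of distinct `k i x₀` stay in the same order.
  obtain ⟨ε, hε, hgap⟩ : ∃ ε > 0, ∀ i j, i < j → 2 * ε < k i x₀ - k j x₀ := by
    have hfin : ∀ p : Fin ℓ × Fin ℓ, ∀ᶠ ε in nhdsWithin (0 : ℝ) (Set.Ioi 0),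
        p.1 < p.2 → 2 * ε < k p.1 x₀ - k p.2 x₀ := by
      intro p
      by_cases hp : p.1 < p.2
      · have hpos : 0 < (k p.1 x₀ - k p.2 x₀) / 2 := half_pos (sub_pos.2 (hk x₀ hp))
        filter_upwards [Ioo_mem_nhdsGT hpos] with ε hε _
        linarith [hε.2]
      · exact Filter.Eventually.of_forall fun ε h => absurd h hp
    obtain ⟨ε, h1, h2⟩ := ((Filter.eventually_all.2 hfin).and self_mem_nhdsWithin).exists
    exact ⟨ε, h2, fun i j hij => h1 (i, j) hij⟩
  have hclose : ∀ᶠ x in nhds x₀, |κ x - κ x₀| < ε :=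
    Metric.continuousAt_iff'.1 hκ ε hε
  filter_upwards [hmem, hclose, Filter.eventually_all.2 fun i => hlow i ε hε] with x
    ⟨j₀, hj₀⟩ hx hall
  -- The index near `k i₀ x₀` is forced to be the one realizing `κ x`. The resulting `σ` is a
  -- strictly increasing self-map of `Fin ℓ`, hence the identity, so `j₀ = i₀`.
  have hex : ∀ i, ∃ j, |k j x - k i x₀| < ε ∧ (i = i₀ → j = j₀) := fun i => by
    by_cases hi : i = i₀
    · exact ⟨j₀, by rwa [hj₀, hi, hi₀], fun _ => rfl⟩
    · obtain ⟨j, hj⟩ := hall i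
      exact ⟨j, hj, fun h => absurd h hi⟩
  choose σ hσ hσ₀ using hex
  have hmono : StrictMono σ := fun i j hij => by
    have h1 := abs_lt.1 (hσ i)
    have h2 := abs_lt.1 (hσ j)
    have h3 := hgap i j hij
    exact (hk x).lt_iff_gt.1 (by linarith [h1.1, h2.2] : k (σ j) x < k (σ i) x)
  have hid : σ = id := hmono.eq_id
  rw [← hj₀, ← hσ₀ i₀ rfl, hid]
  rfl

end Pencil

/-! ### Invariance of the mean curvature function under reparametrization. -/

section ChangeOfParameters

variable {m : ℕ}

/-- The mean curvature function does not depend on the parametrization. -/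
theorem scalarMeanCurvature_eq_of_fderiv {F N F' N' : EuclideanSpace ℝ (Fin m) → Ambient m}
    {u u' : EuclideanSpace ℝ (Fin m)}
    (T : EuclideanSpace ℝ (Fin m) → EuclideanSpace ℝ (Fin m))
    (hF : ∀ w, fderiv ℝ F u w = fderiv ℝ F' u' (T w))
    (hN : ∀ w, fderiv ℝ N u w = fderiv ℝ N' u' (T w))
    (hdet : IsUnit (inducedMetric F u).det) :
    scalarMeanCurvature F N u = scalarMeanCurvature F' N' u' := by
  let J : Matrix (Fin m) (Fin m) ℝ := Matrix.of fun l i => T (EuclideanSpace.single i 1) l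
  have pF : ∀ i, pd i F u = ∑ l, J l i • pd l F' u' := fun i => by
    rw [pd, hF, fderiv_eq_sum_pd]
    rfl
  have pN : ∀ i, pd i N u = ∑ l, J l i • pd l N' u' := fun i => by
    rw [pd, hN, fderiv_eq_sum_pd]
    rfl
  have hg : inducedMetric F u = J.transpose * inducedMetric F' u' * J := by
    ext i j
    rw [inducedMetric_apply, pF, pF, Matrix.mul_assoc, Matrix.mul_apply]
    simp only [sum_inner, inner_sum, inner_smul_left, inner_smul_right, Matrix.mul_apply,
      Matrix.transpose_apply, inducedMetric_apply, conj_trivial, Finset.mul_sum]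
    rw [Finset.sum_comm]
    exact Finset.sum_congr rfl fun a _ => Finset.sum_congr rfl fun b _ => by ring
  have hh : shapeForm F N u = J.transpose * shapeForm F' N' u' * J := by
    ext i j
    rw [shapeForm_apply, pF, pN, Matrix.mul_assoc, Matrix.mul_apply]
    simp only [sum_inner, inner_sum, inner_smul_left, inner_smul_right, Matrix.mul_apply,
      Matrix.transpose_apply, shapeForm_apply, conj_trivial, Finset.mul_sum,
      ← Finset.sum_neg_distrib]
    rw [Finset.sum_comm]
    exact Finset.sum_congr rfl fun a _ => Finset.sum_congr rfl fun b _ => by ring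
  -- Invertibility of the Jacobian comes for free from `g = Jᵀ g' J` with `g` nondegenerate.
  have hJ : IsUnit J.det := by
    rw [hg, Matrix.det_mul] at hdet
    exact isUnit_of_mul_isUnit_right hdet
  have tr : ∀ (F N : EuclideanSpace ℝ (Fin m) → Ambient m) (u : EuclideanSpace ℝ (Fin m)),
      ∑ i, ∑ j, (inducedMetric F u)⁻¹ i j * shapeForm F N u i j =
        ((inducedMetric F u)⁻¹ * shapeForm F N u).trace := fun F N u => by
    rw [Finset.sum_comm]
    simp only [Matrix.trace, Matrix.diag, Matrix.mul_apply]
    exact Finset.sum_congr rfl fun i _ => Finset.sum_congr rfl fun j _ => by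
      rw [inv_inducedMetric_symm]
  have hJt : IsUnit J.transpose.det := by rwa [Matrix.det_transpose]
  rw [scalarMeanCurvature, scalarMeanCurvature, tr, tr, hg, hh, Matrix.mul_inv_rev,
    Matrix.mul_inv_rev]
  congr 1
  have e : J⁻¹ * ((inducedMetric F' u')⁻¹ * J.transpose⁻¹) *
      (J.transpose * shapeForm F' N' u' * J) =
      J⁻¹ * ((inducedMetric F' u')⁻¹ * shapeForm F' N' u' * J) := by
    simp only [Matrix.mul_assoc]
    rw [← Matrix.mul_assoc J.transpose⁻¹, Matrix.nonsing_inv_mul _ hJt, Matrix.one_mul]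
  rw [e, Matrix.trace_mul_comm, Matrix.mul_assoc, Matrix.mul_nonsing_inv _ hJ, Matrix.mul_one]

end ChangeOfParameters

/-! ### Passage between the manifold and its charts. -/

section Charts

variable {m : ℕ} {M : Type*} [TopologicalSpace M] [ChartedSpace (EuclideanSpace ℝ (Fin m)) M]
  {φ : M → UnitSphere m} {η : M → Ambient m}
  {e e' : OpenPartialHomeomorph M (EuclideanSpace ℝ (Fin m))} {u : EuclideanSpace ℝ (Fin m)}

theorem IsSmoothImmersion.contMDiff_coe (hφ : IsSmoothImmersion φ) :
    ContMDiff (𝓡 m) 𝓘(ℝ, Ambient m) ∞ fun y => (φ y : Ambient m) := by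
  have := Fact.mk (@finrank_euclideanSpace_fin ℝ _ (m + 1 + 1))
  exact contMDiff_coe_sphere.comp hφ.1

theorem IsSmoothImmersion.injective_dmap (hφ : IsSmoothImmersion φ) (x : M) :
    Function.Injective (dmap φ x) := by
  have := Fact.mk (@finrank_euclideanSpace_fin ℝ _ (m + 1 + 1))
  have h1 : MDifferentiableAt (𝓡 m) (𝓡 (m + 1)) φ x := hφ.1.mdifferentiableAt (by simp)
  have h2 : MDifferentiableAt (𝓡 (m + 1)) 𝓘(ℝ, Ambient m)
      ((↑) : UnitSphere m → Ambient m) (φ x) :=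
    contMDiff_coe_sphere.mdifferentiableAt one_ne_zero
  have e : dmap φ x = mfderiv (𝓡 (m + 1)) 𝓘(ℝ, Ambient m) ((↑) : UnitSphere m → Ambient m) (φ x) ∘
      mfderiv (𝓡 m) (𝓡 (m + 1)) φ x := by
    ext1 v
    exact congrArg (fun L => L v) (mfderiv_comp x h2 h1)
  rw [e]
  exact (by convert! injective_mvfderiv_subtypeVal_sphere (φ x) : Function.Injective
    (mfderiv (𝓡 (m + 1)) 𝓘(ℝ, Ambient m) ((↑) : UnitSphere m → Ambient m) (φ x))).comp (hφ.2 x)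

/-- The derivative of the inverse of a chart. -/
def dsymm (e : OpenPartialHomeomorph M (EuclideanSpace ℝ (Fin m))) (u w : EuclideanSpace ℝ (Fin m)) :
    TangentSpace (𝓡 m) (e.symm u) :=
  mfderiv (𝓡 m) (𝓡 m) e.symm u w

variable [IsManifold (𝓡 m) ∞ M]

theorem contMDiffOn_symm_of_mem_atlas (he : e ∈ atlas (EuclideanSpace ℝ (Fin m)) M) :
    ContMDiffOn (𝓡 m) (𝓡 m) ∞ e.symm e.target :=
  contMDiffOn_symm_of_mem_maximalAtlas (IsManifold.subset_maximalAtlas he)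

theorem mdifferentiable_of_mem_smooth_atlas (he : e ∈ atlas (EuclideanSpace ℝ (Fin m)) M) :
    e.MDifferentiable (𝓡 m) (𝓡 m) := by
  have : IsManifold (𝓡 m) 1 M := IsManifold.of_le (n := ∞) (by simp)
  exact mdifferentiable_of_mem_atlas he

theorem contDiffOn_comp_symm {f : M → Ambient m} (hf : ContMDiff (𝓡 m) 𝓘(ℝ, Ambient m) ∞ f)
    (he : e ∈ atlas (EuclideanSpace ℝ (Fin m)) M) :
    ContDiffOn ℝ ∞ (fun u => f (e.symm u)) e.target :=
  contMDiffOn_iff_contDiffOn.1 (hf.comp_contMDiffOn (contMDiffOn_symm_of_mem_atlas he))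

theorem fderiv_comp_symm {f : M → Ambient m} (hf : ContMDiff (𝓡 m) 𝓘(ℝ, Ambient m) ∞ f)
    (he : e ∈ atlas (EuclideanSpace ℝ (Fin m)) M) (hu : u ∈ e.target)
    (w : EuclideanSpace ℝ (Fin m)) :
    fderiv ℝ (fun u => f (e.symm u)) u w =
      mfderiv (𝓡 m) 𝓘(ℝ, Ambient m) f (e.symm u) (dsymm e u w) := by
  have h1 : MDifferentiableAt (𝓡 m) (𝓡 m) e.symm u :=
    (mdifferentiable_of_mem_smooth_atlas he).mdifferentiableAt_symm hu
  have h2 : MDifferentiableAt (𝓡 m) 𝓘(ℝ, Ambient m) f (e.symm u) :=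
    hf.mdifferentiableAt (by simp)
  have := mfderiv_comp u h2 h1
  rw [← mfderiv_eq_fderiv]
  exact congrArg (fun L => L w) this

theorem dsymm_mfderiv (he : e ∈ atlas (EuclideanSpace ℝ (Fin m)) M) {x : M} (hx : x ∈ e.source)
    (v : TangentSpace (𝓡 m) x) :
    dsymm e (e x) (mfderiv (𝓡 m) (𝓡 m) e x v) = v :=
  congrArg (fun L => L v) ((mdifferentiable_of_mem_smooth_atlas he).symm_comp_deriv hx)

theorem mfderiv_dsymm (he : e ∈ atlas (EuclideanSpace ℝ (Fin m)) M) (hu : u ∈ e.target)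
    (w : EuclideanSpace ℝ (Fin m)) :
    mfderiv (𝓡 m) (𝓡 m) e (e.symm u) (dsymm e u w) = w :=
  congrArg (fun L => L w) ((mdifferentiable_of_mem_smooth_atlas he).comp_symm_deriv hu)

theorem IsUnitNormalField.isLocalHypersurface (hη : IsUnitNormalField φ η)
    (hφ : IsSmoothImmersion φ) (he : e ∈ atlas (EuclideanSpace ℝ (Fin m)) M) :
    IsLocalHypersurface (inChart φ e) (fun u => η (e.symm u)) e.target where
  isOpen := e.open_target
  contDiffOn := contDiffOn_comp_symm hφ.contMDiff_coe he
  contDiffOn_normal := contDiffOn_comp_symm hη.smooth he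
  norm_eq_one u _ := norm_eq_of_mem_sphere (φ (e.symm u))
  norm_normal u _ := hη.norm_eq_one _
  inner_normal u _ := hη.tangent_sphere _
  inner_pd_normal u hu i := by
    have := hη.normal (e.symm u) (dsymm e u (EuclideanSpace.single i 1))
    rwa [dmap, ← fderiv_comp_symm hφ.contMDiff_coe he hu] at this
  injective u hu w w' hw := by
    have := hφ.injective_dmap _ ((fderiv_comp_symm hφ.contMDiff_coe he hu w).symm.trans
      (hw.trans (fderiv_comp_symm hφ.contMDiff_coe he hu w')))
    rw [← mfderiv_dsymm he hu w, this, mfderiv_dsymm he hu]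

/-- The two coordinate expressions differ by the derivative of the transition map, and the same
normal `η` is used in both, so even the sign agrees. -/
theorem scalarMeanCurvature_eq_of_chart (hη : IsUnitNormalField φ η)
    (hφ : IsSmoothImmersion φ) (he : e ∈ atlas (EuclideanSpace ℝ (Fin m)) M)
    (he' : e' ∈ atlas (EuclideanSpace ℝ (Fin m)) M) {x : M} (hx : x ∈ e.source)
    (hx' : x ∈ e'.source) :
    scalarMeanCurvature (inChart φ e) (fun u => η (e.symm u)) (e x) =
      scalarMeanCurvature (inChart φ e') (fun u => η (e'.symm u)) (e' x) := by
  have hu := e.map_source hx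
  have hu' := e'.map_source hx'
  have key : ∀ {f : M → Ambient m}, ContMDiff (𝓡 m) 𝓘(ℝ, Ambient m) ∞ f → ∀ w,
      fderiv ℝ (fun u => f (e.symm u)) (e x) w = fderiv ℝ (fun u => f (e'.symm u)) (e' x)
        (mfderiv (𝓡 m) (𝓡 m) e' x (mfderiv (𝓡 m) (𝓡 m) e.symm (e x) w)) := by
    intro f hf w
    have h1 : ∀ w', (mfderiv (𝓡 m) 𝓘(ℝ, Ambient m) f (e.symm (e x)) w' : Ambient m) =
        mfderiv (𝓡 m) 𝓘(ℝ, Ambient m) f x w' := by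
      rw [e.left_inv hx]
      exact fun _ => rfl
    have h2 : ∀ w', (mfderiv (𝓡 m) 𝓘(ℝ, Ambient m) f (e'.symm (e' x)) w' : Ambient m) =
        mfderiv (𝓡 m) 𝓘(ℝ, Ambient m) f x w' := by
      rw [e'.left_inv hx']
      exact fun _ => rfl
    refine ((fderiv_comp_symm hf he hu w).trans (h1 _)).trans
      (Eq.trans ?_ ((fderiv_comp_symm hf he' hu' _).trans (h2 _)).symm)
    exact congrArg _ (dsymm_mfderiv he' hx' _).symm
  exact scalarMeanCurvature_eq_of_fderiv _ (key hφ.contMDiff_coe) (key hη.smooth)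
    ((hη.isLocalHypersurface hφ he).isUnit_det hu)

/-- The shape operator in a chart. -/
theorem shapeEigen_dsymm_iff (hη : IsUnitNormalField φ η) (hφ : IsSmoothImmersion φ)
    (he : e ∈ atlas (EuclideanSpace ℝ (Fin m)) M) (hu : u ∈ e.target) (κ : ℝ)
    (w : EuclideanSpace ℝ (Fin m)) :
    ShapeEigen φ η (e.symm u) κ (dsymm e u w) ↔
      ∀ i, ∑ j, shapeForm (inChart φ e) (fun u => η (e.symm u)) u i j * w j =
        κ * ∑ j, inducedMetric (inChart φ e) u i j * w j := by
  have h := hη.isLocalHypersurface hφ he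
  set F := inChart φ e with hF
  set N : EuclideanSpace ℝ (Fin m) → Ambient m := fun u => η (e.symm u) with hN
  have e1 : dmap φ (e.symm u) (dsymm e u w) = ∑ j, w j • pd j F u := by
    rw [← fderiv_eq_sum_pd]
    exact (fderiv_comp_symm hφ.contMDiff_coe he hu w).symm
  have e2 : pullbackConn φ η (e.symm u) (dsymm e u w) = ∑ j, w j • pd j N u := by
    have : (mfderiv (𝓡 m) 𝓘(ℝ, Ambient m) η (e.symm u) (dsymm e u w) : Ambient m) =
        ∑ j, w j • pd j N u := by
      rw [← fderiv_eq_sum_pd]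
      exact (fderiv_comp_symm hη.smooth he hu w).symm
    rw [pullbackConn, this, tangentProj]
    change _ - ⟪F u, _⟫ • _ = _
    simp [inner_sum, inner_smul_right, h.inner_pd_normal_self hu]
  have iL : ∀ i, ⟪-∑ j, w j • pd j N u, pd i F u⟫ = ∑ j, shapeForm F N u i j * w j := fun i => by
    rw [inner_neg_left, sum_inner, ← Finset.sum_neg_distrib]
    refine Finset.sum_congr rfl fun j _ => ?_
    rw [inner_smul_left, shapeForm_apply, real_inner_comm, conj_trivial]
    ring
  have iR : ∀ i, ⟪κ • ∑ j, w j • pd j F u, pd i F u⟫ = κ * ∑ j, inducedMetric F u i j * w j :=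
      fun i => by
    rw [inner_smul_left, sum_inner, conj_trivial]
    congr 1
    refine Finset.sum_congr rfl fun j _ => ?_
    rw [inner_smul_left, inducedMetric_apply, real_inner_comm, conj_trivial, mul_comm]
  rw [ShapeEigen, e1, e2]
  constructor
  · intro heq i
    rw [← iL, ← iR, heq]
  · intro hi
    refine h.ext_inner hu (fun i => by rw [iL, iR, hi]) ?_ ?_
    · rw [inner_neg_left, inner_smul_left, sum_inner, sum_inner]
      simp only [inner_smul_left, real_inner_comm (N u) (pd _ N u), h.inner_normal_pd_normal hu,
        h.inner_pd_normal u hu]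
      simp
    · rw [inner_neg_left, inner_smul_left, sum_inner, sum_inner]
      simp only [inner_smul_left, real_inner_comm (F u) (pd _ N u), h.inner_pd_normal_self hu,
        real_inner_comm (F u) (pd _ F u), h.inner_pd_self hu]
      simp

/-- The derivative of the chart is an isomorphism, so nonzero eigenvectors of the shape operator
correspond to nonzero kernel vectors of the pencil. -/
theorem mem_principalCurvatures_iff (hη : IsUnitNormalField φ η) (hφ : IsSmoothImmersion φ)
    (he : e ∈ atlas (EuclideanSpace ℝ (Fin m)) M) (hu : u ∈ e.target) (κ : ℝ) :
    κ ∈ principalCurvatures φ η (e.symm u) ↔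
      (shapeForm (inChart φ e) (fun u => η (e.symm u)) u
        - κ • inducedMetric (inChart φ e) u).det = 0 := by
  rw [det_sub_smul_eq_zero_iff]
  constructor
  · rintro ⟨v, hv, hκ⟩
    have hx := e.map_target hu
    let w : EuclideanSpace ℝ (Fin m) := mfderiv (𝓡 m) (𝓡 m) e (e.symm u) v
    have hw : dsymm e u w = v :=
      (mdifferentiable_of_mem_smooth_atlas he).mfderiv_injective hx (mfderiv_dsymm he hu w)
    refine ⟨w, fun h0 => hv ?_, (shapeEigen_dsymm_iff hη hφ he hu κ w).1 (by rwa [hw])⟩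
    have h0' : w = 0 := by
      ext i
      exact congrFun h0 i
    rw [← hw, h0']
    exact map_zero (mfderiv (𝓡 m) (𝓡 m) e.symm u)
  · rintro ⟨w, hw, hκ⟩
    refine ⟨dsymm e u (WithLp.toLp 2 w), fun h0 => hw ?_,
      (shapeEigen_dsymm_iff hη hφ he hu κ (WithLp.toLp 2 w)).2 hκ⟩
    have h1 := mfderiv_dsymm he hu (WithLp.toLp 2 w)
    rw [h0] at h1
    have h2 : (0 : EuclideanSpace ℝ (Fin m)) = WithLp.toLp 2 w :=
      (map_zero (mfderiv (𝓡 m) (𝓡 m) e (e.symm u))).symm.trans h1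
    funext i
    exact (congrFun (congrArg WithLp.ofLp h2) i).symm

end Charts

/-! ### The Dupin condition forces the gradient of the mean curvature to vanish. -/

section Dupin

variable {m : ℕ} {M : Type*} [TopologicalSpace M] [ChartedSpace (EuclideanSpace ℝ (Fin m)) M]
  [IsManifold (𝓡 m) ∞ M] {φ : M → UnitSphere m} {η : M → Ambient m}
  {e : OpenPartialHomeomorph M (EuclideanSpace ℝ (Fin m))} {u : EuclideanSpace ℝ (Fin m)}

/-- If the number of distinct principal curvatures is constant, a continuous selection of principal
curvatures is locally one of the ordered principal curvature functions. -/
theorem eventually_eq_principalCurvature (hη : IsUnitNormalField φ η) (hφ : IsSmoothImmersion φ)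
    (he : e ∈ atlas (EuclideanSpace ℝ (Fin m)) M) (hu : u ∈ e.target) {ℓ : ℕ}
    {k : Fin ℓ → M → ℝ} (hk : ∀ x, StrictAnti fun i => k i x)
    (hkr : ∀ x, principalCurvatures φ η x = Set.range fun i => k i x)
    {κ : EuclideanSpace ℝ (Fin m) → ℝ} (hκ : ContinuousAt κ u)
    (hmem : ∀ᶠ y in nhds u, κ y ∈ principalCurvatures φ η (e.symm y)) :
    ∃ i, (fun y => k i (e.symm y)) =ᶠ[nhds u] κ := by
  have h := hη.isLocalHypersurface hφ he
  have ht : ∀ᶠ y in nhds u, y ∈ e.target := e.open_target.mem_nhds hu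
  refine eventually_eq_of_strictAnti (k := fun i y => k i (e.symm y)) (fun y => hk (e.symm y))
    (fun i ε hε => ?_) hκ ?_
  · have hcont : ∀ {A : EuclideanSpace ℝ (Fin m) → Matrix (Fin m) (Fin m) ℝ},
        (∀ a b, ContDiffOn ℝ ∞ (fun y => A y a b) e.target) → ContinuousAt A u := fun hA =>
      continuousAt_pi.2 fun a => continuousAt_pi.2 fun b =>
        (hA a b).continuousOn.continuousAt (e.open_target.mem_nhds hu)
    have hmem₀ : k i (e.symm u) ∈ principalCurvatures φ η (e.symm u) := by
      rw [hkr]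
      exact ⟨i, rfl⟩
    filter_upwards [ht, eventually_exists_det_sub_smul_eq_zero (hcont h.contDiffOn_inducedMetric)
      (hcont h.contDiffOn_shapeForm)
      (ht.mono fun y hy => inducedMetric_posDef (h.injective y hy))
      (ht.mono fun y hy => Matrix.IsHermitian.ext fun a b => h.shapeForm_symm hy b a)
      ((mem_principalCurvatures_iff hη hφ he hu _).1 hmem₀) hε] with y hy hex
    obtain ⟨μ, hμ, hdet⟩ := hex
    have := (mem_principalCurvatures_iff hη hφ he hy μ).2 hdet
    rw [hkr] at this
    obtain ⟨j, hj⟩ := this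
    refine ⟨j, ?_⟩
    simp only at hj ⊢
    rwa [hj]
  · filter_upwards [hmem] with y hy
    rw [hkr] at hy
    exact hy

/-- The mean curvature of a biharmonic proper Dupin hypersurface is locally constant. -/
theorem fderiv_scalarMeanCurvature_eq_zero (hη : IsUnitNormalField φ η)
    (hφ : IsSmoothImmersion φ) (hD : IsProperDupin φ) (hb : IsBiharmonic φ)
    (he : e ∈ atlas (EuclideanSpace ℝ (Fin m)) M) (hu : u ∈ e.target) :
    fderiv ℝ (scalarMeanCurvature (inChart φ e) fun u => η (e.symm u)) u = 0 := by
  have h := hη.isLocalHypersurface hφ he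
  set F := inChart φ e with hF
  set N : EuclideanSpace ℝ (Fin m) → Ambient m := fun u => η (e.symm u) with hN
  set f := scalarMeanCurvature F N with hf
  have hfs : ContDiffOn ℝ ∞ f e.target := h.contDiffOn_scalarMeanCurvature
  have ht : ∀ᶠ y in nhds u, y ∈ e.target := e.open_target.mem_nhds hu
  by_contra hne
  obtain ⟨p, hp⟩ : ∃ p, pd p f u ≠ 0 := by
    by_contra! hall
    refine hne (ContinuousLinearMap.ext fun w => ?_)
    simp [fderiv_eq_sum_pd, hall]
  have hm : (m : ℝ) ≠ 0 := Nat.cast_ne_zero.2 (by rintro rfl; exact p.elim0)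
  -- The coordinates of `grad f`.
  let w : EuclideanSpace ℝ (Fin m) → EuclideanSpace ℝ (Fin m) := fun y =>
    WithLp.toLp 2 fun j => ∑ i, (inducedMetric F y)⁻¹ j i * pd i f y
  have hw : ∀ y j, w y j = ∑ i, (inducedMetric F y)⁻¹ j i * pd i f y := fun _ _ => rfl
  have hgw : ∀ y ∈ e.target, ∀ i, ∑ j, inducedMetric F y i j * w y j = pd i f y := by
    intro y hy i
    have h1 : (inducedMetric F y).mulVec ((inducedMetric F y)⁻¹.mulVec fun i => pd i f y) =
        fun i => pd i f y := by
      rw [Matrix.mulVec_mulVec, Matrix.mul_nonsing_inv _ (h.isUnit_det hy), Matrix.one_mulVec]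
    exact congrFun h1 i
  have hshape : ∀ y ∈ e.target,
      ShapeEigen φ η (e.symm y) (-(m / 2 * f y)) (dsymm e y (w y)) := fun y hy => by
    rw [shapeEigen_dsymm_iff hη hφ he hy]
    intro i
    rw [hgw y hy, ← h.sum_shapeForm_mul_grad hy hm (hb e he y hy)]
    exact Finset.sum_congr rfl fun j _ => mul_comm _ _
  have hdw : ∀ y, dsymm e y (w y) = 0 → y ∈ e.target → w y = 0 := fun y h0 hy => by
    have h1 := mfderiv_dsymm he hy (w y)
    rw [h0] at h1
    exact h1.symm.trans (map_zero (mfderiv (𝓡 m) (𝓡 m) e (e.symm y)))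
  have hw0 : ∀ y ∈ e.target, pd p f y ≠ 0 → w y ≠ 0 := fun y hy hpy h0 => hpy <| by
    rw [← hgw y hy p, h0]
    simp
  obtain ⟨ℓ, k, hk, hkr, hkD⟩ := hD η hη
  have hdf := differentiableAt_of_contDiffOn e.open_target hfs hu
  let κ : EuclideanSpace ℝ (Fin m) → ℝ := fun y => -(m / 2 * f y)
  have hκ : DifferentiableAt ℝ κ u := (hdf.const_mul _).fun_neg
  -- `∂_p f` stays nonzero near `u`, so `grad f` is a genuine eigenvector on a whole neighbourhood.
  obtain ⟨i, hi⟩ := eventually_eq_principalCurvature hη hφ he hu hk hkr hκ.continuousAt (by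
    have hpc : ContinuousAt (pd p f) u :=
      (contDiffOn_pd e.open_target hfs p).continuousOn.continuousAt (e.open_target.mem_nhds hu)
    filter_upwards [ht, hpc.eventually_ne hp] with y hy hpy
    exact ⟨_, fun h0 => hw0 y hy hpy (hdw y h0 hy), hshape y hy⟩)
  have hx := e.map_target hu
  -- `mfderiv` is zero by convention where a function is not differentiable, so the Dupin condition
  -- has content only once `k i` is known to agree near the point with a differentiable function.
  have heq : k i =ᶠ[nhds (e.symm u)] fun x => -(m / 2 * f (e x)) := by
    have hc : Filter.Tendsto e (nhds (e.symm u)) (nhds u) := by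
      have := e.continuousAt hx
      rwa [ContinuousAt, e.right_inv hu] at this
    filter_upwards [hc.eventually hi, e.open_source.mem_nhds hx] with x h1 h2
    simpa [e.left_inv h2] using h1
  have hzero := hkD i (e.symm u) (dsymm e u (w u)) (by
    have : k i (e.symm u) = -(m / 2 * f u) := hi.self_of_nhds
    rw [this]
    exact hshape u hu)
  have hder : (mfderiv (𝓡 m) 𝓘(ℝ, ℝ) (k i) (e.symm u) (dsymm e u (w u)) : ℝ) =
      fderiv ℝ κ u (w u) := by
    have he1 : MDifferentiableAt (𝓡 m) (𝓡 m) e (e.symm u) :=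
      (mdifferentiable_of_mem_smooth_atlas he).mdifferentiableAt hx
    have hκ' : HasMFDerivAt (𝓡 m) 𝓘(ℝ, ℝ) κ (e (e.symm u))
        (fderiv ℝ κ u) := by
      rw [e.right_inv hu]
      exact hκ.hasFDerivAt.hasMFDerivAt
    have hcomp := (hκ'.comp (e.symm u) he1.hasMFDerivAt).congr_of_eventuallyEq heq
    rw [hcomp.mfderiv]
    exact congrArg (fderiv ℝ κ u) (mfderiv_dsymm he hu (w u))
  have hfw : fderiv ℝ f u (w u) = 0 := by
    have h1 := hder.symm.trans hzero
    rw [show κ = fun y => -(m / 2 * f y) from rfl, fderiv_fun_neg, fderiv_const_mul hdf] at h1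
    have h2 : -((m : ℝ) / 2 * fderiv ℝ f u (w u)) = 0 := h1
    have hm2 : (m : ℝ) / 2 ≠ 0 := div_ne_zero hm two_ne_zero
    simpa [hm2] using h2
  -- `|grad f|² = df(grad f)`.
  have hnorm : ⟪fderiv ℝ F u (w u), fderiv ℝ F u (w u)⟫ = (0 : ℝ) := by
    rw [← hfw, fderiv_eq_sum_pd, fderiv_eq_sum_pd, sum_inner]
    refine Finset.sum_congr rfl fun a _ => ?_
    rw [inner_smul_left, inner_sum, ← hgw u hu a]
    simp only [inner_smul_right, inducedMetric_apply, conj_trivial, smul_eq_mul]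
    congr 1
    exact Finset.sum_congr rfl fun b _ => mul_comm _ _
  exact hw0 u hu hp (h.injective u hu (by rw [inner_self_eq_zero.1 hnorm, map_zero]))

end Dupin

end SphereHypersurface

end

/-! ### From local to global constancy. -/

theorem mainTheorem3 (m : ℕ) {M : Type*} [TopologicalSpace M] [T2Space M]
    [SecondCountableTopology M] [ConnectedSpace M]
    [ChartedSpace (EuclideanSpace ℝ (Fin m)) M] [IsManifold (𝓡 m) ∞ M]
    (φ : M → SphereHypersurface.UnitSphere m)
    (hφ : SphereHypersurface.IsSmoothImmersion φ)
    (hor : SphereHypersurface.IsOrientableHypersurface φ)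
    (hDupin : SphereHypersurface.IsProperDupin φ)
    (hbih : SphereHypersurface.IsProperBiharmonic φ) :
    SphereHypersurface.IsCMC φ := by
  open SphereHypersurface in
  obtain ⟨η, hη⟩ := hor
  -- Each point uses its own preferred chart. Local constancy is proved in one fixed chart, and
  -- chart independence then transfers it to `f`.
  let f : M → ℝ := fun x =>
    scalarMeanCurvature (inChart φ (chartAt (EuclideanSpace ℝ (Fin m)) x))
      (fun u => η ((chartAt (EuclideanSpace ℝ (Fin m)) x).symm u))
      (chartAt (EuclideanSpace ℝ (Fin m)) x x)
  have hH : ∀ x, ‖meanCurvatureVector φ x‖ = |f x| := fun x => by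
    rw [meanCurvatureVector, (hη.isLocalHypersurface hφ (chart_mem_atlas _ x)).localMeanCurvature_eq
      (mem_chart_target _ x), norm_smul, hη.norm_eq_one, mul_one, Real.norm_eq_abs]
  have hloc : IsLocallyConstant f := by
    rw [IsLocallyConstant.iff_eventually_eq]
    intro x
    set e := chartAt (EuclideanSpace ℝ (Fin m)) x with he
    have hea : e ∈ atlas (EuclideanSpace ℝ (Fin m)) M := chart_mem_atlas _ x
    have hx : x ∈ e.source := mem_chart_source _ x
    obtain ⟨r, hr, hball⟩ := Metric.isOpen_iff.1 e.open_target (e x) (e.map_source hx)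
    have hconst : ∀ y ∈ Metric.ball (e x) r,
        scalarMeanCurvature (inChart φ e) (fun u => η (e.symm u)) y =
          scalarMeanCurvature (inChart φ e) (fun u => η (e.symm u)) (e x) := fun y hy =>
      Metric.isOpen_ball.is_const_of_fderiv_eq_zero (convex_ball _ _).isPreconnected
        (fun z hz => (differentiableAt_of_contDiffOn e.open_target
          (hη.isLocalHypersurface hφ hea).contDiffOn_scalarMeanCurvature
          (hball hz)).differentiableWithinAt)
        (fun z hz => fderiv_scalarMeanCurvature_eq_zero hη hφ hDupin hbih.1 hea (hball hz))
        hy (Metric.mem_ball_self hr)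
    filter_upwards [e.open_source.mem_nhds hx,
      (e.continuousAt hx).preimage_mem_nhds (Metric.ball_mem_nhds _ hr)] with y hy hy'
    refine Eq.trans ?_ (hconst (e y) hy')
    exact scalarMeanCurvature_eq_of_chart hη hφ (chart_mem_atlas _ y) hea (mem_chart_source _ y) hy
  obtain ⟨c, hc⟩ := hloc.exists_eq_const
  exact ⟨|c|, fun x => by rw [hH, hc]; rfl⟩
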